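/- A decision problem is a set $\mathcal P$ of pairs $\langle D,P\rangle$ of binary strings, where $D$ is the data part and $P$ is the problem part. A function $f$ on binary strings is NC computable if a PRAM computes $f(x)$ in time $O(\log^{O(1)}|x|)$ with $|x|^{O(1)}$ processors. A random-access Turing machine (RATM) is a Turing machine with read-only input tapes, finitely many work tapes, and one binary index tape for each of these (non-index) tapes; when it enters its random access state, the head of each non-index tape moves in one step to the cell whose number is written on the corresponding index tape. A function $g(x,y)$ on pairs of binary strings is PPL computable if an RATM with $x$ and $y$ on its input tapes writes $g(x,y)$ on its output tape and halts within time $O(\log^{c} n)$ for some constant $c$, where $n=|x|+|y|$ is the length of the input. A decision problem $\mathcal P_1$ is pseudo-polylog-time reducible to $\mathcal P_2$, written $\mathcal P_1\le^{\mathrm{PsPL}}_m\mathcal P_2$, if there are NC computable functions $f_1,f_2$ and a PPL computable function $g$ such that for all binary strings $D,P$ $$\langle D,P\rangle\in\mathcal P_1\iff\langle f_1(D),\,g(f_2(D),P)\rangle\in\mathcal P_2 .$$ **Theorem.** If $\mathcal P_1\le^{\mathrm{PsPL}}_m\mathcal P_2$ and $\mathcal P_2\le^{\mathrm{PsPL}}_m\mathcal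 P_3$, then $\mathcal P_1\le^{\mathrm{PsPL}}_m\mathcal P_3$. -/

import Mathlib

/-! ### Decision problems

All strings are binary strings, `List Bool`.  A decision problem whose input is split into a data
part `D` and a problem part `P` is the set of the pairs `(D, P)` for which the answer is "yes". -/

/-- A decision problem on pairs (data part, problem part). -/
abbrev DecisionProblem : Type := Set (List Bool × List Bool)

/-! ### NC: polylogarithmic parallel time with polynomially many processors

The parallel machine is a synchronous PRAM with a single stream of instructions.  The shared memory
is organised in arrays of natural numbers; names of arrays are natural numbers, and a program
mentions only finitely many of them.  Arithmetic is restricted to addition, truncated subtraction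
and halving, so that unit cost is justified. -/

namespace PRAM

/-- Content of the shared memory: `σ A j` is entry `j` of array `A`. -/
abbrev Store : Type := ℕ → ℕ → ℕ

/-- Expressions that one processor evaluates in one parallel step. -/
inductive Expr : Type
  /-- a constant -/
  | const (c : ℕ) : Expr
  /-- the number of the processor that evaluates the expression -/
  | pid : Expr
  /-- the entry of array `A` whose position is the value of `e` -/
  | read (A : ℕ) (e : Expr) : Expr
  | add (e₁ e₂ : Expr) : Expr
  | sub (e₁ e₂ : Expr) : Expr
  | half (e : Expr) : Expr
  /-- `e₁` if the value of `e` is not zero, and `e₂` otherwise -/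
  | cond (e e₁ e₂ : Expr) : Expr

/-- Value of an expression for processor `i`. -/
def Expr.eval (σ : Store) (i : ℕ) : Expr → ℕ
  | .const c => c
  | .pid => i
  | .read A e => σ A (e.eval σ i)
  | .add e₁ e₂ => e₁.eval σ i + e₂.eval σ i
  | .sub e₁ e₂ => e₁.eval σ i - e₂.eval σ i
  | .half e => e.eval σ i / 2
  | .cond e e₁ e₂ => if e.eval σ i ≠ 0 then e₁.eval σ i else e₂.eval σ i

/-- Programs. -/
inductive Program : Type
  /-- `for all i < count in parallel do A[addr] := val` -/
  | pardo (count : Expr) (A : ℕ) (addr val : Expr) : Program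
  /-- one program after the other -/
  | seq (c₁ c₂ : Program) : Program
  /-- repeat `c` as long as `e` is not zero; the guard `e` is evaluated by processor `0` -/
  | loop (e : Expr) (c : Program) : Program

open Classical in
/-- The memory after processors `0, …, m - 1` have simultaneously executed `A[addr] := val`.
All reads precede all writes; if several processors write to the same entry, the one with the
smallest number succeeds (priority CRCW). -/
noncomputable def write (σ : Store) (m A : ℕ) (addr val : Expr) : Store := fun B j =>
  if B = A ∧ ∃ i, i < m ∧ addr.eval σ i = j then
    val.eval σ (sInf {i | i < m ∧ addr.eval σ i = j})
  else σ B j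

/-- `Exec p c σ σ' t`: program `c`, started with memory `σ`, halts with memory `σ'` after exactly
`t` parallel steps, and no step uses more than `p` processors. -/
inductive Exec (p : ℕ) : Program → Store → Store → ℕ → Prop
  | pardo {σ : Store} {count : Expr} {A : ℕ} {addr val : Expr} :
      count.eval σ 0 ≤ p →
      Exec p (.pardo count A addr val) σ (write σ (count.eval σ 0) A addr val) 1
  | seq {σ σ' σ'' : Store} {t t' : ℕ} {c₁ c₂ : Program} :
      Exec p c₁ σ σ' t → Exec p c₂ σ' σ'' t' → Exec p (.seq c₁ c₂) σ σ'' (t + t')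
  | loop_done {σ : Store} {e : Expr} {c : Program} :
      e.eval σ 0 = 0 → Exec p (.loop e c) σ σ 1
  | loop_step {σ σ' σ'' : Store} {t t' : ℕ} {e : Expr} {c : Program} :
      e.eval σ 0 ≠ 0 → Exec p c σ σ' t → Exec p (.loop e c) σ' σ'' t' →
      Exec p (.loop e c) σ σ'' (1 + t + t')

/-- The number that represents a symbol in memory: `0` for a blank, `1` for the bit `false` and
`2` for the bit `true`. -/
def code : Option Bool → ℕ
  | none => 0
  | some false => 1
  | some true => 2

/-- Initial memory for input `x`: the string is in array `0`, its length is entry `0` of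
array `1`, and everything else is `0`. -/
def initStore (x : List Bool) : Store := fun A j =>
  if A = 0 then code x[j]? else if A = 1 ∧ j = 0 then x.length else 0

/-- The memory `σ` holds the output `y`: the string is in array `2` and its length is entry `0`
of array `3`. -/
def HasOutput (σ : Store) (y : List Bool) : Prop :=
  σ 3 0 = y.length ∧ ∀ j, j < y.length → σ 2 j = code y[j]?

end PRAM

/-- `f` is NC computable: a PRAM computes it in polylogarithmic time with polynomially many
processors. -/
def NCComputable (f : List Bool → List Bool) : Prop :=
  ∃ (c : PRAM.Program) (d k : ℕ), ∀ x : List Bool, ∃ (σ : PRAM.Store) (t : ℕ),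
    PRAM.Exec (d * (x.length + 1) ^ k) c (PRAM.initStore x) σ t ∧
      t ≤ d * (Nat.log 2 x.length + 1) ^ k ∧ PRAM.HasOutput σ (f x)

/-! ### Random-access Turing machines

Every tape is one-way infinite, with cells numbered by natural numbers. -/

/-- Movement of a head. -/
inductive HeadMove : Type
  | left
  | stay
  | right

/-- New position of a head; a left move in cell `0` has no effect. -/
def HeadMove.apply : HeadMove → ℕ → ℕ
  | .left, n => n - 1
  | .stay, n => n
  | .right, n => n + 1

/-- What a machine with states `Q`, input tapes `I`, work tapes `W` and work symbols `S` does in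
one step.  The non-index tapes are `I ⊕ W`, and there is one index tape for each of them. -/
structure RATMAction (Q I W S : Type) where
  /-- the new state -/
  next : Q
  /-- the symbols written on the work tapes -/
  write : W → S
  /-- the bits written on the index tapes -/
  writeIndex : I ⊕ W → Bool
  /-- the moves of the heads of the non-index tapes -/
  move : I ⊕ W → HeadMove
  /-- the moves of the heads of the index tapes -/
  moveIndex : I ⊕ W → HeadMove

/-- A random-access Turing machine with `a` read-only input tapes (one for each argument of the
function that it computes), finitely many work tapes, and one binary index tape for each of these
tapes.  A symbol on a work tape is a blank (`none`), a bit, or an auxiliary symbol. -/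
structure RATM (a : ℕ) where
  /-- the states -/
  State : Type
  finite_state : Finite State
  /-- the work tapes -/
  Work : Type
  finite_work : Finite Work
  /-- the auxiliary symbols -/
  Aux : Type
  finite_aux : Finite Aux
  /-- the work tape that receives the output -/
  out : Work
  /-- the initial state -/
  start : State
  /-- the random access state -/
  access : State
  /-- the transition function: given the state and the symbols under the heads of the input tapes,
  the work tapes and the index tapes, the action, or `none` if the machine halts -/
  δ : State → (Fin a → Option Bool) → (Work → Option (Bool ⊕ Aux)) → (Fin a ⊕ Work → Bool) →
    Option (RATMAction State (Fin a) Work (Option (Bool ⊕ Aux)))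

namespace RATM

variable {a : ℕ}

/-- Configurations. -/
structure Cfg (M : RATM a) where
  state : M.State
  /-- the contents of the work tapes -/
  work : M.Work → ℕ → Option (Bool ⊕ M.Aux)
  /-- the contents of the index tapes: the finite set of the cells that hold a `1`; all other cells
  hold a `0` -/
  index : Fin a ⊕ M.Work → Finset ℕ
  /-- the positions of the heads of the non-index tapes -/
  head : Fin a ⊕ M.Work → ℕ
  /-- the positions of the heads of the index tapes -/
  indexHead : Fin a ⊕ M.Work → ℕ

/-- The number on an index tape, in binary, with the least significant bit in cell `0`. -/
def address (s : Finset ℕ) : ℕ := ∑ j ∈ s, 2 ^ j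

/-- The initial configuration: the work tapes are blank, the index tapes hold `0`, and all heads
are on cell `0`. -/
def init (M : RATM a) : M.Cfg where
  state := M.start
  work := fun _ _ => none
  index := fun _ => ∅
  head := fun _ => 0
  indexHead := fun _ => 0

/-- The action that the machine takes on input `x` in configuration `c`. -/
noncomputable def action (M : RATM a) (x : Fin a → List Bool) (c : M.Cfg) :
    Option (RATMAction M.State (Fin a) M.Work (Option (Bool ⊕ M.Aux))) :=
  M.δ c.state (fun i => (x i)[c.head (Sum.inl i)]?) (fun w => c.work w (c.head (Sum.inr w)))
    (fun T => decide (c.indexHead T ∈ c.index T))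

/-- The contents of the index tapes after the action `A`. -/
def newIndex {M : RATM a} (c : M.Cfg)
    (A : RATMAction M.State (Fin a) M.Work (Option (Bool ⊕ M.Aux))) :
    Fin a ⊕ M.Work → Finset ℕ := fun T =>
  if A.writeIndex T then insert (c.indexHead T) (c.index T)
  else (c.index T).erase (c.indexHead T)

open Classical in
/-- The configuration after the action `A`.  When the random access state is entered, the head of
each non-index tape moves to the cell described by its index tape. -/
noncomputable def act {M : RATM a} (c : M.Cfg)
    (A : RATMAction M.State (Fin a) M.Work (Option (Bool ⊕ M.Aux))) : M.Cfg where
  state := A.next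
  work := fun w => Function.update (c.work w) (c.head (Sum.inr w)) (A.write w)
  index := newIndex c A
  head := fun T =>
    if A.next = M.access then address (newIndex c A T) else (A.move T).apply (c.head T)
  indexHead := fun T => (A.moveIndex T).apply (c.indexHead T)

/-- One step on input `x`; a halted machine keeps its configuration. -/
noncomputable def step (M : RATM a) (x : Fin a → List Bool) (c : M.Cfg) : M.Cfg :=
  match M.action x c with
  | none => c
  | some A => act c A

/-- On input `x`, the machine halts after at most `t` steps, and its output tape then holds the
string `y`, starting in cell `0`, and otherwise blanks. -/
def OutputsWithin (M : RATM a) (x : Fin a → List Bool) (t : ℕ) (y : List Bool) : Prop :=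
  M.action x ((M.step x)^[t] M.init) = none ∧
    ∀ j, ((M.step x)^[t] M.init).work M.out j = (y[j]?).map Sum.inl

end RATM

/-- The function `g` of `a` strings is PPL computable: a random-access Turing machine computes it in
time polylogarithmic in the length of the input, which is the total length of the arguments. -/
def PPLComputable {a : ℕ} (g : (Fin a → List Bool) → List Bool) : Prop :=
  ∃ (M : RATM a) (d k : ℕ), ∀ x : Fin a → List Bool,
    M.OutputsWithin x (d * (Nat.log 2 (∑ i, (x i).length) + 1) ^ k) (g x)

/-! ### The reduction -/

/-- Pseudo-polylog-time reducibility of decision problems. -/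
def PsPLReducible (P₁ P₂ : DecisionProblem) : Prop :=
  ∃ (f₁ f₂ : List Bool → List Bool) (g : List Bool → List Bool → List Bool),
    NCComputable f₁ ∧ NCComputable f₂ ∧
    PPLComputable (fun x : Fin 2 → List Bool => g (x 0) (x 1)) ∧
    ∀ D P : List Bool, (D, P) ∈ P₁ ↔ (f₁ D, g (f₂ D) P) ∈ P₂

/-! Substituting one reduction into the other shows that `(D, P)` is a yes-instance of the first
problem iff `(f₁' (f₁ D), g' (f₂' (f₁ D)) (g (f₂ D) P))` is one of the third. So the new data map is
`f₁' ∘ f₁`, the new preprocessing sends `D` to a code `pairEnc u v` of the pair `u = f₂' (f₁ D)`, `v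
= f₂ D`, and the new query map has to send `pairEnc u v`, `P` to `g' u (g v P)`. It remains to see
that NC is closed under composition and pairing, and that this query map extends to a PPL computable
function.

For NC, programs run one after the other in disjoint families of arrays. An intermediate string has
polynomial length, since `p` processors make at most `p * t` entries nonzero in `t` steps and codes
of bits are nonzero (`HasOutput.length_le`); hence `NCComputable.comp` and `NCComputable.pair`.

For PPL, polylogarithmic time does not suffice to unpack the pair, so it is read in place. Its code
consists of blocks of four cells, and shifting an index tape by two cells multiplies the address by
four; `decode` thus simulates a machine on either component with constant slowdown. `compose` runs
two machines in sequence, the output tape of the first serving as an input tape of the second. The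
string `g v P` is no longer than the time spent on it, so the second machine also meets a
polylogarithmic bound in the original length.

The remaining obstacle is totality: a PPL function must be computed in time on every input, but
strings that are not codes of pairs may decode to tapes with gaps, about which the given machines
promise nothing. So `clock` cuts the run off after polylogarithmically many steps, having found the
logarithm of the input length by probing powers of two, and `copier` extracts a string from whatever
is on the output tape. This gives `RATM.exists_pplComputable` and then `PPLComputable.exists_comp`.
-/

/-! ### Polynomial and polylogarithmic bounds -/

/-- `f` is bounded by a polynomial. -/
def PolyBdd (f : ℕ → ℕ) : Prop := ∃ d k : ℕ, ∀ n, f n ≤ d * (n + 1) ^ k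

/-- `f` is bounded by a polynomial in the logarithm. -/
def PolylogBdd (f : ℕ → ℕ) : Prop := ∃ d k : ℕ, ∀ n, f n ≤ d * (Nat.log 2 n + 1) ^ k

namespace PolyBdd

theorem mono {f g : ℕ → ℕ} (hg : PolyBdd g) (h : ∀ n, f n ≤ g n) : PolyBdd f := by
  obtain ⟨d, k, hd⟩ := hg
  exact ⟨d, k, fun n => (h n).trans (hd n)⟩

theorem const (c : ℕ) : PolyBdd fun _ => c := ⟨c, 0, fun n => by simp⟩

theorem id : PolyBdd fun n => n := ⟨1, 1, fun n => by simp⟩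

theorem monomial (d k : ℕ) : PolyBdd fun n => d * (n + 1) ^ k := ⟨d, k, fun _ => le_rfl⟩

theorem add {f g : ℕ → ℕ} (hf : PolyBdd f) (hg : PolyBdd g) : PolyBdd fun n => f n + g n := by
  obtain ⟨d, k, hd⟩ := hf
  obtain ⟨e, l, he⟩ := hg
  refine ⟨d + e, k + l, fun n => ?_⟩
  have h1 : (n + 1) ^ k ≤ (n + 1) ^ (k + l) := Nat.pow_le_pow_right (by omega) (by omega)
  have h2 : (n + 1) ^ l ≤ (n + 1) ^ (k + l) := Nat.pow_le_pow_right (by omega) (by omega)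
  calc f n + g n ≤ d * (n + 1) ^ k + e * (n + 1) ^ l := add_le_add (hd n) (he n)
    _ ≤ d * (n + 1) ^ (k + l) + e * (n + 1) ^ (k + l) := by gcongr
    _ = _ := by ring

theorem mul {f g : ℕ → ℕ} (hf : PolyBdd f) (hg : PolyBdd g) : PolyBdd fun n => f n * g n := by
  obtain ⟨d, k, hd⟩ := hf
  obtain ⟨e, l, he⟩ := hg
  refine ⟨d * e, k + l, fun n => ?_⟩
  calc f n * g n ≤ (d * (n + 1) ^ k) * (e * (n + 1) ^ l) := Nat.mul_le_mul (hd n) (he n)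
    _ = _ := by ring

theorem pow {f : ℕ → ℕ} (hf : PolyBdd f) (m : ℕ) : PolyBdd fun n => f n ^ m := by
  induction m with
  | zero => simpa using const 1
  | succ m ih => simpa [pow_succ] using ih.mul hf

theorem comp {f g : ℕ → ℕ} (hf : PolyBdd f) (hg : PolyBdd g) : PolyBdd fun n => f (g n) := by
  obtain ⟨d, k, hd⟩ := hf
  exact (((const d).mul ((hg.add (const 1)).pow k))).mono fun n => hd (g n)

end PolyBdd

namespace PolylogBdd

theorem mono {f g : ℕ → ℕ} (hg : PolylogBdd g) (h : ∀ n, f n ≤ g n) : PolylogBdd f := by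
  obtain ⟨d, k, hd⟩ := hg
  exact ⟨d, k, fun n => (h n).trans (hd n)⟩

theorem of_polyBdd {p : ℕ → ℕ} (hp : PolyBdd p) : PolylogBdd fun n => p (Nat.log 2 n) := by
  obtain ⟨d, k, hd⟩ := hp
  exact ⟨d, k, fun n => hd _⟩

theorem exists_polyBdd {f : ℕ → ℕ} (hf : PolylogBdd f) :
    ∃ p : ℕ → ℕ, PolyBdd p ∧ ∀ n, f n ≤ p (Nat.log 2 n) := by
  obtain ⟨d, k, hd⟩ := hf
  exact ⟨_, PolyBdd.monomial d k, hd⟩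

theorem monomial (d k : ℕ) : PolylogBdd fun n => d * (Nat.log 2 n + 1) ^ k :=
  ⟨d, k, fun _ => le_rfl⟩

theorem const (c : ℕ) : PolylogBdd fun _ => c := of_polyBdd (PolyBdd.const c)

theorem add {f g : ℕ → ℕ} (hf : PolylogBdd f) (hg : PolylogBdd g) :
    PolylogBdd fun n => f n + g n := by
  obtain ⟨p, hp, hfp⟩ := hf.exists_polyBdd
  obtain ⟨q, hq, hgq⟩ := hg.exists_polyBdd
  exact (of_polyBdd (hp.add hq)).mono fun n => add_le_add (hfp n) (hgq n)

theorem mul {f g : ℕ → ℕ} (hf : PolylogBdd f) (hg : PolylogBdd g) :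
    PolylogBdd fun n => f n * g n := by
  obtain ⟨p, hp, hfp⟩ := hf.exists_polyBdd
  obtain ⟨q, hq, hgq⟩ := hg.exists_polyBdd
  exact (of_polyBdd (hp.mul hq)).mono fun n => Nat.mul_le_mul (hfp n) (hgq n)

theorem comp_left {p f : ℕ → ℕ} (hp : PolyBdd p) (hf : PolylogBdd f) :
    PolylogBdd fun n => p (f n) := by
  obtain ⟨d, k, hd⟩ := hp
  obtain ⟨e, l, he⟩ := hf
  refine (of_polyBdd ((PolyBdd.monomial d k).comp (PolyBdd.monomial e l))).mono fun n => ?_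
  refine (hd _).trans ?_
  have := he n
  gcongr

theorem polyBdd {f : ℕ → ℕ} (hf : PolylogBdd f) : PolyBdd f := by
  obtain ⟨d, k, hd⟩ := hf
  refine ⟨d, k, fun n => (hd n).trans ?_⟩
  have := Nat.log_le_self 2 n
  gcongr

/-- Since `n + 1 ≤ 2 ^ (log n + 1)`, a polynomial in `n` is at most `2` to a power that is linear in
`log n`. Hence polylogarithmic time stays polylogarithmic when the input grows polynomially. -/
theorem log_of_polyBdd {f : ℕ → ℕ} (hf : PolyBdd f) : PolylogBdd fun n => Nat.log 2 (f n) := by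
  obtain ⟨d, k, hd⟩ := hf
  refine ⟨d + k, 1, fun n => ?_⟩
  have h1 : n + 1 ≤ 2 ^ (Nat.log 2 n + 1) := Nat.lt_pow_succ_log_self (by omega) n
  have h2 : f n ≤ 2 ^ (d + k * (Nat.log 2 n + 1)) := by
    calc f n ≤ d * (n + 1) ^ k := hd n
      _ ≤ 2 ^ d * (2 ^ (Nat.log 2 n + 1)) ^ k := by
        gcongr
        exact Nat.lt_two_pow_self.le
      _ = _ := by rw [mul_comm k, pow_add 2 d, pow_mul]
  calc Nat.log 2 (f n) ≤ Nat.log 2 (2 ^ (d + k * (Nat.log 2 n + 1))) := Nat.log_mono_right h2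
    _ = d + k * (Nat.log 2 n + 1) := Nat.log_pow (by omega) _
    _ ≤ (d + k) * (Nat.log 2 n + 1) ^ 1 := by nlinarith [Nat.zero_le (d * Nat.log 2 n)]

theorem comp_polyBdd {f g : ℕ → ℕ} (hf : PolylogBdd f) (hg : PolyBdd g) :
    PolylogBdd fun n => f (g n) := by
  obtain ⟨d, k, hd⟩ := hf
  exact (comp_left (PolyBdd.monomial d k) (log_of_polyBdd hg)).mono fun n => hd _

end PolylogBdd

/-! ### PRAM programs: renaming of arrays, copying, subroutine calls -/

namespace PRAM

/-- Renaming of the arrays of an expression. -/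
def Expr.map (ρ : ℕ → ℕ) : Expr → Expr
  | .const c => .const c
  | .pid => .pid
  | .read A e => .read (ρ A) (e.map ρ)
  | .add e₁ e₂ => .add (e₁.map ρ) (e₂.map ρ)
  | .sub e₁ e₂ => .sub (e₁.map ρ) (e₂.map ρ)
  | .half e => .half (e.map ρ)
  | .cond e e₁ e₂ => .cond (e.map ρ) (e₁.map ρ) (e₂.map ρ)

/-- Renaming of the arrays of a program. -/
def Program.map (ρ : ℕ → ℕ) : Program → Program
  | .pardo count A addr val => .pardo (count.map ρ) (ρ A) (addr.map ρ) (val.map ρ)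
  | .seq c₁ c₂ => .seq (c₁.map ρ) (c₂.map ρ)
  | .loop e c => .loop (e.map ρ) (c.map ρ)

theorem Expr.eval_map {ρ : ℕ → ℕ} {σ τ : Store} (h : ∀ A, τ (ρ A) = σ A) (i : ℕ) (e : Expr) :
    (e.map ρ).eval τ i = e.eval σ i := by
  induction e <;> simp_all [Expr.map, Expr.eval]

theorem write_of_ne (σ : Store) (m : ℕ) {A B : ℕ} (addr val : Expr) (h : B ≠ A) :
    write σ m A addr val B = σ B := by
  funext j
  simp [write, h]

theorem write_map {ρ : ℕ → ℕ} (hρ : Function.Injective ρ) {σ τ : Store}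
    (h : ∀ A, τ (ρ A) = σ A) (m A : ℕ) (addr val : Expr) (B : ℕ) :
    write τ m (ρ A) (addr.map ρ) (val.map ρ) (ρ B) = write σ m A addr val B := by
  funext j
  simp only [write, Expr.eval_map h, hρ.eq_iff, h]

/-- Arrays are addressed only by names fixed in the program, so an injective renaming commutes with
every step. This lets several programs share one memory without interference. -/
theorem Exec.map {ρ : ℕ → ℕ} (hρ : Function.Injective ρ) {p : ℕ} {c : Program} {σ σ' : Store}
    {t : ℕ} (hc : Exec p c σ σ' t) {τ : Store} (h : ∀ A, τ (ρ A) = σ A) :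
    ∃ τ', Exec p (c.map ρ) τ τ' t ∧ (∀ A, τ' (ρ A) = σ' A) ∧
      ∀ B, B ∉ Set.range ρ → τ' B = τ B := by
  induction hc generalizing τ with
  | @pardo σ count A addr val hp =>
    refine ⟨write τ (count.eval σ 0) (ρ A) (addr.map ρ) (val.map ρ), ?_, ?_, ?_⟩
    · have := Exec.pardo (p := p) (σ := τ) (count := count.map ρ) (A := ρ A)
        (addr := addr.map ρ) (val := val.map ρ)
      rw [Expr.eval_map h] at this
      exact this hp
    · exact fun B => write_map hρ h _ _ _ _ _
    · intro B hB
      exact write_of_ne _ _ _ _ fun hBA => hB ⟨A, hBA.symm⟩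
  | seq _ _ ih₁ ih₂ =>
    obtain ⟨τ₁, e₁, h₁, f₁⟩ := ih₁ h
    obtain ⟨τ₂, e₂, h₂, f₂⟩ := ih₂ h₁
    exact ⟨τ₂, e₁.seq e₂, h₂, fun B hB => (f₂ B hB).trans (f₁ B hB)⟩
  | loop_done he =>
    exact ⟨τ, .loop_done (by rwa [Expr.eval_map h]), h, fun _ _ => rfl⟩
  | loop_step he _ _ ih₁ ih₂ =>
    obtain ⟨τ₁, e₁, h₁, f₁⟩ := ih₁ h
    obtain ⟨τ₂, e₂, h₂, f₂⟩ := ih₂ h₁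
    exact ⟨τ₂, .loop_step (by rwa [Expr.eval_map h]) e₁ e₂, h₂,
      fun B hB => (f₂ B hB).trans (f₁ B hB)⟩

theorem Exec.mono {p q : ℕ} (hpq : p ≤ q) {c : Program} {σ σ' : Store} {t : ℕ}
    (hc : Exec p c σ σ' t) : Exec q c σ σ' t := by
  induction hc with
  | pardo h => exact .pardo (h.trans hpq)
  | seq _ _ ih₁ ih₂ => exact .seq ih₁ ih₂
  | loop_done he => exact .loop_done he
  | loop_step he _ _ ih₁ ih₂ => exact .loop_step he ih₁ ih₂

theorem write_support (σ : Store) (m A : ℕ) (addr val : Expr) (B : ℕ) :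
    {j | write σ m A addr val B j ≠ 0} ⊆
      {j | σ B j ≠ 0} ∪ ((Finset.range m).image fun i => addr.eval σ i : Finset ℕ) := by
  intro j hj
  by_cases h : B = A ∧ ∃ i, i < m ∧ addr.eval σ i = j
  · right
    obtain ⟨i, hi, rfl⟩ := h.2
    simp only [Finset.coe_image, Finset.coe_range]
    exact ⟨i, hi, rfl⟩
  · left
    simpa [write, h] using hj

/-- At most `p * t` entries of an array become nonzero in `t` steps with `p` processors. -/
theorem Exec.support {p : ℕ} {c : Program} {σ σ' : Store} {t : ℕ} (hc : Exec p c σ σ' t)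
    (B : ℕ) {s : Finset ℕ} (hs : {j | σ B j ≠ 0} ⊆ s) :
    ∃ s' : Finset ℕ, {j | σ' B j ≠ 0} ⊆ s' ∧ s'.card ≤ s.card + p * t := by
  induction hc generalizing s with
  | @pardo σ count A addr val hp =>
    refine ⟨s ∪ (Finset.range (count.eval σ 0)).image fun i => addr.eval σ i, ?_, ?_⟩
    · refine (write_support _ _ _ _ _ _).trans ?_
      rw [Finset.coe_union]
      exact Set.union_subset_union_left _ hs
    · refine (Finset.card_union_le _ _).trans ?_
      have := Finset.card_image_le (s := Finset.range (count.eval σ 0))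
        (f := fun i => addr.eval σ i)
      rw [Finset.card_range] at this
      omega
  | @seq σ σ' σ'' t t' _ _ _ _ ih₁ ih₂ =>
    obtain ⟨s₁, h₁, e₁⟩ := ih₁ hs
    obtain ⟨s₂, h₂, e₂⟩ := ih₂ h₁
    exact ⟨s₂, h₂, by rw [mul_add]; omega⟩
  | loop_done he => exact ⟨s, hs, by omega⟩
  | @loop_step σ σ' σ'' t t' _ _ _ _ _ ih₁ ih₂ =>
    obtain ⟨s₁, h₁, e₁⟩ := ih₁ hs
    obtain ⟨s₂, h₂, e₂⟩ := ih₂ h₁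
    exact ⟨s₂, h₂, by rw [mul_add, mul_add]; omega⟩

theorem write_pid (σ : Store) (m A : ℕ) (val : Expr) (B j : ℕ) :
    write σ m A .pid val B j = if B = A ∧ j < m then val.eval σ j else σ B j := by
  by_cases h : j < m
  · have : {i | i < m ∧ i = j} = {j} := by
      ext i
      simp only [Set.mem_ofPred_eq, Set.mem_singleton_iff]
      omega
    simp [write, Expr.eval, h, this]
  · have : ¬ ∃ i, i < m ∧ i = j := by rintro ⟨i, hi, rfl⟩; exact h hi
    simp [write, Expr.eval, h]

theorem write_const_zero (σ : Store) (A : ℕ) (val : Expr) (B j : ℕ) :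
    write σ 1 A (.const 0) val B j = if B = A ∧ j = 0 then val.eval σ 0 else σ B j := by
  by_cases h : j = 0
  · have : {i | i < 1 ∧ 0 = j} = {0} := by ext i; simp [h]
    simp [write, Expr.eval, h]
  · simp [write, Expr.eval, h, Ne.symm h]

/-- Array `A` starts with the string `y`, whose length is entry `0` of array `B`. -/
def Holds (σ : Store) (A B : ℕ) (y : List Bool) : Prop :=
  σ B 0 = y.length ∧ ∀ j, j < y.length → σ A j = code y[j]?

/-- The memory after the string `y` has been stored in arrays `A` and `B`. -/
def stored (σ : Store) (A B : ℕ) (y : List Bool) : Store := fun C j =>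
  if C = A ∧ j < y.length then code y[j]? else if C = B ∧ j = 0 then y.length else σ C j

/-- Copy the string in arrays `A`, `B` to arrays `A'`, `B'`. -/
def copy (A B A' B' : ℕ) : Program :=
  .seq (.pardo (.read B (.const 0)) A' .pid (.read A .pid))
    (.pardo (.const 1) B' (.const 0) (.read B (.const 0)))

theorem exec_copy {p : ℕ} {σ : Store} {A B A' B' : ℕ} {y : List Bool} (h : Holds σ A B y)
    (hy : y.length ≤ p) (hp : 1 ≤ p) (h₁ : B ≠ A') (h₂ : A' ≠ B') :
    Exec p (copy A B A' B') σ (stored σ A' B' y) 2 := by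
  have e₁ : Exec p (.pardo (.read B (.const 0)) A' .pid (.read A .pid)) σ
      (write σ y.length A' .pid (.read A .pid)) 1 := by
    have := Exec.pardo (p := p) (σ := σ) (count := .read B (.const 0)) (A := A') (addr := .pid)
      (val := .read A .pid)
    simp only [Expr.eval, h.1] at this
    exact this hy
  have e₂ := Exec.pardo (p := p) (σ := write σ y.length A' .pid (.read A .pid))
    (count := .const 1) (A := B') (addr := .const 0) (val := .read B (.const 0)) hp
  have e₃ := e₁.seq e₂
  suffices hσ : stored σ A' B' y = write (write σ y.length A' .pid (.read A .pid)) 1 B'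
      (.const 0) (.read B (.const 0)) by
    rw [hσ]
    exact e₃
  funext C j
  -- The length is read again after the string has been written; `h₁` ensures that it has not been
  -- overwritten.
  simp only [Expr.eval, write_const_zero, write_pid, stored, h.1, h₁, false_and, if_false]
  by_cases hC : C = A' ∧ j < y.length
  · rw [if_pos hC, if_pos hC, if_neg (by rintro ⟨rfl, -⟩; exact h₂ hC.1.symm), h.2 j hC.2]
  · rw [if_neg hC, if_neg hC]

/-- Entries past the end of `y` must be `0`, the code of a blank; this is why a subroutine is called
only on arrays that are still zero. -/
theorem stored_map {ρ : ℕ → ℕ} (hρ : Function.Injective ρ) {σ : Store}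
    (h : ∀ C, σ (ρ C) = fun _ => 0) (y : List Bool) (C : ℕ) :
    stored σ (ρ 0) (ρ 1) y (ρ C) = initStore y C := by
  funext j
  simp only [stored, initStore, hρ.eq_iff, h]
  by_cases h0 : C = 0
  · subst h0
    by_cases hj : j < y.length
    · simp [hj]
    · simp [hj, code]
  · simp [h0]

theorem holds_initStore (x : List Bool) : Holds (initStore x) 0 1 x := by
  simp [Holds, initStore]

theorem holds_stored {σ : Store} {A B : ℕ} (h : A ≠ B) (y : List Bool) :
    Holds (stored σ A B y) A B y := by
  refine ⟨?_, fun j hj => ?_⟩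
  · simp [stored, h.symm]
  · simp [stored, hj]

/-- Run `c`, with its arrays renamed by `ρ`, on the string in arrays `A` and `B`. -/
def call (ρ : ℕ → ℕ) (c : Program) (A B : ℕ) : Program :=
  .seq (copy A B (ρ 0) (ρ 1)) (c.map ρ)

theorem exec_call {ρ : ℕ → ℕ} (hρ : Function.Injective ρ) {p : ℕ} {c : Program}
    {σ σ₁ : Store} {t : ℕ} {x y : List Bool} {A B : ℕ} (hx : Holds σ A B x)
    (hσ : ∀ C, σ (ρ C) = fun _ => 0) (hB : B ∉ Set.range ρ)
    (hc : Exec p c (initStore x) σ₁ t) (hy : HasOutput σ₁ y) (hxp : x.length ≤ p) (hp : 1 ≤ p) :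
    ∃ σ', Exec p (call ρ c A B) σ σ' (2 + t) ∧ Holds σ' (ρ 2) (ρ 3) y ∧
      ∀ C, C ∉ Set.range ρ → σ' C = σ C := by
  have e₁ := exec_copy (A' := ρ 0) (B' := ρ 1) hx hxp hp (fun h => hB ⟨0, h.symm⟩)
    (fun h => absurd (hρ h) (by decide))
  obtain ⟨τ, e₂, hτ, hf⟩ := hc.map hρ (stored_map hρ hσ x)
  refine ⟨τ, e₁.seq e₂, ⟨?_, fun j hj => ?_⟩, fun C hC => ?_⟩
  · rw [hτ]; exact hy.1
  · rw [hτ]; exact hy.2 j hj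
  · rw [hf C hC]
    funext j
    simp only [stored]
    rw [if_neg (by rintro ⟨rfl, -⟩; exact hC ⟨0, rfl⟩),
      if_neg (by rintro ⟨rfl, -⟩; exact hC ⟨1, rfl⟩)]

/-- Array `2` is initially zero and bits are coded by `1` and `2`, so every position of the output
has become nonzero during the run. -/
theorem HasOutput.length_le {p : ℕ} {c : Program} {x : List Bool} {σ : Store} {t : ℕ}
    (hc : Exec p c (initStore x) σ t) {y : List Bool} (hy : HasOutput σ y) :
    y.length ≤ p * t := by
  obtain ⟨s, hs, hcard⟩ := hc.support 2 (s := ∅) (by intro j; simp [initStore])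
  have : Finset.range y.length ⊆ s := by
    intro j hj
    rw [Finset.mem_range] at hj
    refine hs ?_
    simp only [Set.mem_ofPred_eq, hy.2 j hj, List.getElem?_eq_getElem hj]
    cases y[j] <;> simp [code]
  have h := Finset.card_le_card this
  simp only [Finset.card_range, Finset.card_empty] at h hcard
  omega

/-- Two renamings with disjoint ranges that avoid the arrays of the input and of the output. -/
def rename (b : Bool) (A : ℕ) : ℕ := 2 * A + 4 + b.toNat

theorem rename_injective (b : Bool) : Function.Injective (rename b) := by
  intro A B h
  simp only [rename] at h
  omega

theorem notMem_range_rename {b : Bool} {A : ℕ} (h : A < 4) : A ∉ Set.range (rename b) := by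
  rintro ⟨B, hB⟩
  simp only [rename] at hB
  omega

theorem rename_notMem (b : Bool) (A : ℕ) : rename b A ∉ Set.range (rename !b) := by
  rintro ⟨B, hB⟩
  cases b <;> simp [rename] at hB <;> omega

theorem initStore_of_lt {x : List Bool} {A : ℕ} (h : 2 ≤ A) : initStore x A = fun _ => 0 := by
  funext j
  rw [initStore, if_neg (by omega), if_neg (by omega)]

end PRAM

/-! ### Closure of NC computability under composition -/

open PRAM

theorem NCComputable.of_bounds {f : List Bool → List Bool} (c : Program) {p q : ℕ → ℕ}
    (hp : PolyBdd p) (hq : PolylogBdd q)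
    (h : ∀ x : List Bool, ∃ (σ : Store) (t : ℕ), Exec (p x.length) c (initStore x) σ t ∧
      t ≤ q x.length ∧ HasOutput σ (f x)) : NCComputable f := by
  obtain ⟨d, k, hd⟩ := hp
  obtain ⟨e, l, he⟩ := hq
  refine ⟨c, d + e, k + l, fun x => ?_⟩
  obtain ⟨σ, t, h₁, h₂, h₃⟩ := h x
  refine ⟨σ, t, h₁.mono ((hd _).trans ?_), h₂.trans ((he _).trans ?_), h₃⟩
  · exact Nat.mul_le_mul (by omega) (Nat.pow_le_pow_right (by omega) (by omega))
  · exact Nat.mul_le_mul (by omega) (Nat.pow_le_pow_right (by omega) (by omega))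

theorem NCComputable.exists_bounds {f : List Bool → List Bool} (hf : NCComputable f) :
    ∃ (c : Program) (p q : ℕ → ℕ), PolyBdd p ∧ PolylogBdd q ∧ (∀ n, 1 ≤ p n ∧ n ≤ p n) ∧
      ∀ x : List Bool, (f x).length ≤ p x.length ∧ ∃ (σ : Store) (t : ℕ),
        Exec (p x.length) c (initStore x) σ t ∧ t ≤ q x.length ∧ HasOutput σ (f x) := by
  obtain ⟨c, d, k, h⟩ := hf
  have hq := PolylogBdd.monomial d k
  have hp := PolyBdd.monomial d k
  -- The summands provide, in this order, the processors of the run, the bound processors times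
  -- steps on the output length, and enough processors to copy the input.
  refine ⟨c, fun n => (d * (n + 1) ^ k + (d * (n + 1) ^ k) * (d * (Nat.log 2 n + 1) ^ k)) + (n + 1),
    _, (hp.add (hp.mul hq.polyBdd)).add (PolyBdd.id.add (PolyBdd.const 1)), hq,
    fun n => ⟨Nat.le_add_left_of_le (Nat.le_add_left 1 n),
      Nat.le_add_left_of_le (Nat.le_add_right n 1)⟩, fun x => ?_⟩
  obtain ⟨σ, t, h₁, h₂, h₃⟩ := h x
  refine ⟨?_, σ, t, h₁.mono (by simp only [add_assoc]; exact Nat.le_add_right _ _), h₂, h₃⟩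
  have h₄ := h₃.length_le h₁
  have h₅ := Nat.mul_le_mul_left (d * (x.length + 1) ^ k) h₂
  exact (h₄.trans h₅).trans (Nat.le_add_right_of_le (Nat.le_add_left _ _))

theorem NCComputable.comp {f g : List Bool → List Bool} (hg : NCComputable g)
    (hf : NCComputable f) : NCComputable fun x => g (f x) := by
  obtain ⟨c, p, q, hp, hq, hp1, h⟩ := hf.exists_bounds
  obtain ⟨c', p', q', hp', hq', hp1', h'⟩ := hg.exists_bounds
  obtain ⟨d, k, hd⟩ := hp'
  obtain ⟨e, l, he⟩ := hq'
  -- The second call takes its input from where the first leaves its output; the final copy is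
  -- needed because both renamings avoid the output arrays `2` and `3`.
  refine .of_bounds (.seq (call (rename false) c 0 1) (.seq
    (call (rename true) c' (rename false 2) (rename false 3))
    (copy (rename true 2) (rename true 3) 2 3)))
    (p := fun n => p n + d * (p n + 1) ^ k)
    (q := fun n => (2 + q n) + ((2 + e * (Nat.log 2 (p n) + 1) ^ l) + 2))
    (hp.add ((PolyBdd.monomial d k).comp hp))
    (((PolylogBdd.const 2).add hq).add (((PolylogBdd.const 2).add
      ((PolylogBdd.monomial e l).comp_polyBdd hp)).add (.const 2))) fun x => ?_
  obtain ⟨hy, σ₁, t₁, h₁, b₁, o₁⟩ := h x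
  obtain ⟨hz, σ₂, t₂, h₂, b₂, o₂⟩ := h' (f x)
  set P := p x.length + d * (p x.length + 1) ^ k with hP
  have hP₁ : p x.length ≤ P := Nat.le_add_right _ _
  have hP₂ : p' (f x).length ≤ P := by
    refine (hd _).trans (le_trans ?_ (Nat.le_add_left _ _))
    gcongr
  have hx1 := hp1 x.length
  have hy1 := hp1' (f x).length
  obtain ⟨τ₁, e₁, H₁, F₁⟩ := exec_call (rename_injective false) (holds_initStore x)
    (fun C => initStore_of_lt (by simp only [rename]; omega)) (notMem_range_rename (by omega))
    (h₁.mono hP₁) o₁ (by omega) (by omega)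
  obtain ⟨τ₂, e₂, H₂, F₂⟩ := exec_call (rename_injective true) H₁ (fun C => by
      rw [F₁ _ (rename_notMem true C)]
      exact initStore_of_lt (by simp only [rename]; omega))
    (rename_notMem false 3) (h₂.mono hP₂) o₂ (by omega) (by omega)
  have e₃ := exec_copy (p := P) (A' := 2) (B' := 3) H₂ (by omega) (by omega)
    (by simp [rename]) (by omega)
  refine ⟨_, _, e₁.seq (e₂.seq e₃), ?_, holds_stored (by omega) _⟩
  have : t₂ ≤ e * (Nat.log 2 (p x.length) + 1) ^ l := by
    refine b₂.trans ((he _).trans ?_)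
    have := Nat.log_mono_right (b := 2) hy
    gcongr
  omega

/-! ### Pairs of strings -/

/-- Bit `j` of the string that represents the pair `u`, `v`. -/
def pairBit (u v : List Bool) (j : ℕ) : Bool :=
  if j % 4 = 0 then decide (j / 4 < u.length) else
  if j % 4 = 1 then u.getD (j / 4) false else
  if j % 4 = 2 then decide (j / 4 < v.length) else v.getD (j / 4) false

/-- A string that represents the pair `u`, `v`: the cells `4 * i, …, 4 * i + 3` say whether `u` has
a bit `i`, what this bit is, whether `v` has a bit `i`, and what this bit is. -/
def pairEnc (u v : List Bool) : List Bool :=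
  (List.range (4 * max u.length v.length)).map (pairBit u v)

theorem length_pairEnc (u v : List Bool) :
    (pairEnc u v).length = 4 * max u.length v.length := by
  simp [pairEnc]

theorem getElem?_pairEnc (u v : List Bool) (j : ℕ) : (pairEnc u v)[j]? =
    if j < 4 * max u.length v.length then some (pairBit u v j) else none := by
  by_cases h : j < 4 * max u.length v.length <;> simp [pairEnc, h]

namespace PRAM

/-- The expression for entry `pid` of the representation of the pair of the strings in arrays
`A`, `B` and `A'`, `B'`. -/
def pairExpr (A B A' B' : ℕ) : Expr :=
  let i := Expr.half (.half .pid)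
  let r := Expr.sub .pid (.add (.add i i) (.add i i))
  let len (B : ℕ) : Expr := .sub (.read B (.const 0)) i
  .cond r (.cond (.sub r (.const 1)) (.cond (.sub r (.const 2))
    (.cond (len B') (.read A' i) (.const 1))
    (.cond (len B') (.const 2) (.const 1)))
    (.cond (len B) (.read A i) (.const 1)))
    (.cond (len B) (.const 2) (.const 1))

/-- Two halvings and a subtraction give quotient and remainder modulo `4`. Truncated subtraction
acts as a comparison: length minus position is nonzero exactly inside the string. -/
theorem eval_pairExpr {σ : Store} {A B A' B' : ℕ} {u v : List Bool} (hu : Holds σ A B u)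
    (hv : Holds σ A' B' v) (j : ℕ) :
    (pairExpr A B A' B').eval σ j = code (some (pairBit u v j)) := by
  have hi : j / 2 / 2 = j / 4 := by omega
  have hr : j - (j / 4 + j / 4 + (j / 4 + j / 4)) = j % 4 := by omega
  have key : ∀ {A B : ℕ} {w : List Bool}, Holds σ A B w →
      (if w.length - j / 4 ≠ 0 then σ A (j / 4) else 1) = code (some (w.getD (j / 4) false)) := by
    intro A B w hw
    by_cases h : j / 4 < w.length
    · rw [if_pos (by omega), hw.2 _ h, List.getD_eq_getElem?_getD, List.getElem?_eq_getElem h]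
      rfl
    · rw [if_neg (by omega), List.getD_eq_getElem?_getD, List.getElem?_eq_none (by omega)]
      rfl
  have key' : ∀ w : List Bool, (if w.length - j / 4 ≠ 0 then 2 else 1) =
      code (some (decide (j / 4 < w.length))) := by
    intro w
    by_cases h : j / 4 < w.length
    · rw [if_pos (by omega), decide_eq_true h]; rfl
    · rw [if_neg (by omega), decide_eq_false h]; rfl
  simp only [pairExpr, Expr.eval, hi, hr, hu.1, hv.1, key hu, key hv, key', pairBit]
  have h4 : j % 4 < 4 := Nat.mod_lt _ (by omega)
  generalize j % 4 = r at h4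
  interval_cases r <;> simp

end PRAM

theorem NCComputable.pair {f g : List Bool → List Bool} (hf : NCComputable f)
    (hg : NCComputable g) : NCComputable fun x => pairEnc (f x) (g x) := by
  obtain ⟨c, p, q, hp, hq, hp1, h⟩ := hf.exists_bounds
  obtain ⟨c', p', q', hp', hq', hp1', h'⟩ := hg.exists_bounds
  let A := rename false 2
  let B := rename false 3
  let A' := rename true 2
  let B' := rename true 3
  let len (e : Expr) : Expr := .add (.add e e) (.add e e)
  -- With truncated subtraction, `a + (b - a)` is the maximum of the two lengths.
  let cnt : Expr :=
    len (.add (.read B (.const 0)) (.sub (.read B' (.const 0)) (.read B (.const 0))))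
  refine .of_bounds (.seq (call (rename false) c 0 1) (.seq (call (rename true) c' 0 1)
    (.seq (.pardo cnt 2 .pid (pairExpr A B A' B')) (.pardo (.const 1) 3 (.const 0) cnt))))
    (p := fun n => 4 * (p n + p' n)) (q := fun n => (2 + q n) + ((2 + q' n) + (1 + 1)))
    ((PolyBdd.const 4).mul (hp.add hp'))
    (((PolylogBdd.const 2).add hq).add (((PolylogBdd.const 2).add hq').add (.const 2)))
    fun x => ?_
  obtain ⟨hy, σ₁, t₁, h₁, b₁, o₁⟩ := h x
  obtain ⟨hz, σ₂, t₂, h₂, b₂, o₂⟩ := h' x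
  set P := 4 * (p x.length + p' x.length) with hP
  have hx1 := hp1 x.length
  have hy1 := hp1' x.length
  obtain ⟨τ₁, e₁, H₁, F₁⟩ := exec_call (rename_injective false) (holds_initStore x)
    (fun C => initStore_of_lt (by simp only [rename]; omega)) (notMem_range_rename (by omega))
    (h₁.mono (p := p x.length) (q := P) (by omega)) o₁ (by omega) (by omega)
  have hin : Holds τ₁ 0 1 x := by
    unfold Holds
    rw [F₁ 0 (notMem_range_rename (by omega)), F₁ 1 (notMem_range_rename (by omega))]
    exact holds_initStore x
  obtain ⟨τ₂, e₂, H₂, F₂⟩ := exec_call (rename_injective true) hin (fun C => by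
      rw [F₁ _ (rename_notMem true C)]
      exact initStore_of_lt (by simp only [rename]; omega))
    (notMem_range_rename (by omega)) (h₂.mono (p := p' x.length) (q := P) (by omega)) o₂
    (by omega) (by omega)
  have H₁' : Holds τ₂ A B (f x) := by
    unfold Holds
    rw [F₂ A (rename_notMem false 2), F₂ B (rename_notMem false 3)]
    exact H₁
  have hcnt : ∀ σ : Store, σ B 0 = (f x).length → σ B' 0 = (g x).length →
      cnt.eval σ 0 = (pairEnc (f x) (g x)).length := by
    intro σ h₁ h₂
    simp only [cnt, len, Expr.eval, h₁, h₂, length_pairEnc]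
    omega
  have hlen : (pairEnc (f x) (g x)).length ≤ P := by
    rw [length_pairEnc]
    omega
  have hc₂ := hcnt τ₂ H₁'.1 H₂.1
  have e₃ := Exec.pardo (p := P) (σ := τ₂) (count := cnt) (A := 2) (addr := .pid)
    (val := pairExpr A B A' B') (by rw [hc₂]; exact hlen)
  rw [hc₂] at e₃
  set τ₃ := write τ₂ (pairEnc (f x) (g x)).length 2 .pid (pairExpr A B A' B') with hτ₃
  have hc₃ : cnt.eval τ₃ 0 = (pairEnc (f x) (g x)).length := by
    refine hcnt _ ?_ ?_
    · rw [hτ₃, write_of_ne _ _ _ _ (by simp [B, rename])]; exact H₁'.1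
    · rw [hτ₃, write_of_ne _ _ _ _ (by simp [B', rename])]; exact H₂.1
  have e₄ := Exec.pardo (p := P) (σ := τ₃) (count := .const 1) (A := 3) (addr := .const 0)
    (val := cnt) (by simp only [Expr.eval]; omega)
  refine ⟨_, _, e₁.seq (e₂.seq (e₃.seq e₄)), by omega, ?_, fun j hj => ?_⟩
  · simp only [Expr.eval, write_const_zero, hc₃]
    simp
  · simp only [Expr.eval, write_const_zero]
    rw [if_neg (by omega), hτ₃, write_pid, if_pos ⟨rfl, hj⟩, eval_pairExpr H₁' H₂,
      getElem?_pairEnc, if_pos (by rwa [← length_pairEnc])]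

/-! ### Random-access Turing machines on arbitrary input tapes -/

namespace RATM

variable {a b : ℕ}

/-- The contents of the input tapes for the arguments `x`. -/
def tapes (x : Fin a → List Bool) : Fin a → ℕ → Option Bool := fun i j => (x i)[j]?

/-- The action that the machine takes in configuration `c` if its input tapes hold `X`. -/
def actionT (M : RATM a) (X : Fin a → ℕ → Option Bool) (c : M.Cfg) :
    Option (RATMAction M.State (Fin a) M.Work (Option (Bool ⊕ M.Aux))) :=
  M.δ c.state (fun i => X i (c.head (Sum.inl i))) (fun w => c.work w (c.head (Sum.inr w)))
    (fun T => decide (c.indexHead T ∈ c.index T))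

/-- One step with input tapes `X`; a halted machine keeps its configuration. -/
noncomputable def stepT (M : RATM a) (X : Fin a → ℕ → Option Bool) (c : M.Cfg) : M.Cfg :=
  match M.actionT X c with
  | none => c
  | some A => act c A

/-- With input tapes `X`, the machine halts after at most `t` steps, and its output tape then
holds `Y`. -/
def HaltsWith (M : RATM a) (X : Fin a → ℕ → Option Bool) (t : ℕ)
    (Y : ℕ → Option (Bool ⊕ M.Aux)) : Prop :=
  M.actionT X ((M.stepT X)^[t] M.init) = none ∧ ((M.stepT X)^[t] M.init).work M.out = Y

theorem outputsWithin_iff {M : RATM a} {x : Fin a → List Bool} {t : ℕ} {y : List Bool} :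
    M.OutputsWithin x t y ↔ M.HaltsWith (tapes x) t fun j => (y[j]?).map Sum.inl :=
  and_congr Iff.rfl funext_iff.symm

theorem stepT_of_none {M : RATM a} {X : Fin a → ℕ → Option Bool} {c : M.Cfg}
    (h : M.actionT X c = none) : M.stepT X c = c := by
  simp [stepT, h]

theorem stepT_of_some {M : RATM a} {X : Fin a → ℕ → Option Bool} {c : M.Cfg}
    {A : RATMAction M.State (Fin a) M.Work (Option (Bool ⊕ M.Aux))}
    (h : M.actionT X c = some A) : M.stepT X c = act c A := by
  simp [stepT, h]

theorem iterate_stepT_of_none {M : RATM a} {X : Fin a → ℕ → Option Bool} {c : M.Cfg}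
    (h : M.actionT X c = none) (t : ℕ) : (M.stepT X)^[t] c = c :=
  Function.iterate_fixed (stepT_of_none h) t

theorem HaltsWith.mono {M : RATM a} {X : Fin a → ℕ → Option Bool} {t t' : ℕ}
    {Y : ℕ → Option (Bool ⊕ M.Aux)} (h : M.HaltsWith X t Y) (ht : t ≤ t') :
    M.HaltsWith X t' Y := by
  obtain ⟨s, rfl⟩ := Nat.exists_eq_add_of_le ht
  unfold HaltsWith
  rw [add_comm, Function.iterate_add_apply, iterate_stepT_of_none h.1]
  exact h

/-- The contents of a binary tape after the bit `b` has been written at position `h`. -/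
def setBit (s : Finset ℕ) (h : ℕ) (b : Bool) : Finset ℕ := if b then insert h s else s.erase h

theorem setBit_self (s : Finset ℕ) (h : ℕ) : setBit s h (decide (h ∈ s)) = s := by
  by_cases hs : h ∈ s <;> simp [setBit, hs]

section act

variable {M : RATM a} (c : M.Cfg)
  (A : RATMAction M.State (Fin a) M.Work (Option (Bool ⊕ M.Aux)))

@[simp] theorem act_work (w : M.Work) :
    (act c A).work w = Function.update (c.work w) (c.head (Sum.inr w)) (A.write w) := rfl

@[simp] theorem act_index (T : Fin a ⊕ M.Work) :
    (act c A).index T = setBit (c.index T) (c.indexHead T) (A.writeIndex T) := rfl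

@[simp] theorem act_indexHead (T : Fin a ⊕ M.Work) :
    (act c A).indexHead T = (A.moveIndex T).apply (c.indexHead T) := rfl

variable {c A}

theorem act_head_of_ne (h : A.next ≠ M.access) (T : Fin a ⊕ M.Work) :
    (act c A).head T = (A.move T).apply (c.head T) := if_neg h

theorem act_head_of_eq (h : A.next = M.access) (T : Fin a ⊕ M.Work) :
    (act c A).head T = address (setBit (c.index T) (c.indexHead T) (A.writeIndex T)) := if_pos h

end act

theorem address_empty : address ∅ = 0 := rfl

theorem apply_stay (n : ℕ) : HeadMove.stay.apply n = n := rfl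

theorem apply_left (n : ℕ) : HeadMove.left.apply n = n - 1 := rfl

theorem apply_right (n : ℕ) : HeadMove.right.apply n = n + 1 := rfl

theorem move_apply_le (m : HeadMove) (n : ℕ) : m.apply n ≤ n + 1 := by
  cases m <;> simp only [apply_stay, apply_left, apply_right] <;> omega

/-- Step-by-step simulation: if each of the first `T` steps of `M` is simulated by at most `K`
steps of `M'`, then so are `t` steps by at most `K * t`. -/
theorem simulate {M : RATM a} {M' : RATM b} {X : Fin a → ℕ → Option Bool}
    {X' : Fin b → ℕ → Option Bool} {R : ℕ → M.Cfg → M'.Cfg → Prop} {T K : ℕ}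
    (hR : ∀ i, i < T → ∀ c c' A, R i c c' → M.actionT X c = some A →
      ∃ s, s ≤ K ∧ R (i + 1) (act c A) ((M'.stepT X')^[s] c'))
    (t i : ℕ) {c : M.Cfg} {c' : M'.Cfg} (hi : i + t ≤ T) (h : R i c c') :
    ∃ j, j ≤ t ∧ ∃ s, s ≤ K * t ∧ R (i + j) ((M.stepT X)^[t] c) ((M'.stepT X')^[s] c') := by
  induction t generalizing i c c' with
  | zero => exact ⟨0, le_rfl, 0, le_rfl, h⟩
  | succ t ih =>
    cases hA : M.actionT X c with
    -- If `M` has already halted, its configuration is frozen and no step needs to be simulated;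
    -- this is why the number `j` of actual steps may be smaller than `t`.
    | none => exact ⟨0, by omega, 0, by omega, by rwa [iterate_stepT_of_none hA]⟩
    | some A =>
      obtain ⟨s, hs, h₁⟩ := hR i (by omega) c c' A h hA
      obtain ⟨j, hj, s', hs', h₂⟩ := ih (i + 1) (by omega) h₁
      refine ⟨j + 1, by omega, s' + s, by rw [mul_add]; omega, ?_⟩
      rw [Function.iterate_succ_apply, stepT_of_some hA, Function.iterate_add_apply]
      rwa [add_right_comm, add_assoc] at h₂

/-- After `t` steps, at most `t` cells of a work tape are not blank. -/
theorem support_work (M : RATM a) (X : Fin a → ℕ → Option Bool) (w : M.Work) (t : ℕ) :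
    ∃ s : Finset ℕ, s.card ≤ t ∧ ∀ j, ((M.stepT X)^[t] M.init).work w j ≠ none → j ∈ s := by
  induction t with
  | zero => exact ⟨∅, by simp, fun j hj => absurd rfl hj⟩
  | succ t ih =>
    obtain ⟨s, hs, h⟩ := ih
    rw [Function.iterate_succ_apply']
    set c := (M.stepT X)^[t] M.init
    cases hA : M.actionT X c with
    | none => exact ⟨s, by omega, by rwa [stepT_of_none hA]⟩
    | some A =>
      refine ⟨insert (c.head (Sum.inr w)) s, (Finset.card_insert_le _ _).trans (by omega), ?_⟩
      intro j hj
      rw [stepT_of_some hA, act_work] at hj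
      by_cases hjw : j = c.head (Sum.inr w)
      · simp [hjw]
      · rw [Function.update_of_ne hjw] at hj
        exact Finset.mem_insert_of_mem (h j hj)

theorem HaltsWith.exists_support {M : RATM a} {X : Fin a → ℕ → Option Bool} {t : ℕ}
    {Y : ℕ → Option (Bool ⊕ M.Aux)} (h : M.HaltsWith X t Y) :
    ∃ s : Finset ℕ, s.card ≤ t ∧ ∀ j, Y j ≠ none → j ∈ s := by
  obtain ⟨s, hs, hj⟩ := M.support_work X M.out t
  exact ⟨s, hs, by rwa [h.2] at hj⟩

/-- Each step writes only one cell of the output tape. The bound controls the length of the string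
that the first machine of a composition hands to the second. -/
theorem OutputsWithin.length_le {M : RATM a} {x : Fin a → List Bool} {t : ℕ} {y : List Bool}
    (h : M.OutputsWithin x t y) : y.length ≤ t := by
  obtain ⟨s, hs, hj⟩ := (outputsWithin_iff.1 h).exists_support
  have : Finset.range y.length ⊆ s := fun j hjy => hj j (by
    rw [Finset.mem_range] at hjy
    simp [hjy])
  have := Finset.card_le_card this
  rw [Finset.card_range] at this
  omega

end RATM

/-! ### Machines that read one component of a pair -/

namespace RATM

/-- The symbol that a block of four cells represents on the tape of the first (`b = false`) or
second component. -/
def blockSymbol (b : Bool) (r : Fin 4 → Option Bool) : Option Bool :=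
  if b then (if r 2 = some true then r 3 else none) else (if r 0 = some true then r 1 else none)

/-- The tape that `Z` represents if it is divided into blocks of four cells. -/
def blockTape (b : Bool) (Z : ℕ → Option Bool) (h : ℕ) : Option Bool :=
  blockSymbol b fun k => Z (4 * h + k)

/-- The presence bit of a block makes the shorter component read as blank past its end, although the
code continues there for the sake of the longer one. -/
theorem blockTape_pairEnc (b : Bool) (u v : List Bool) :
    blockTape b (fun j => (pairEnc u v)[j]?) = fun j => (if b then v else u)[j]? := by
  funext h
  have h0 : (4 * h + 0) % 4 = 0 ∧ (4 * h + 0) / 4 = h := by omega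
  have h1 : (4 * h + 1) % 4 = 1 ∧ (4 * h + 1) / 4 = h := by omega
  have h2 : (4 * h + 2) % 4 = 2 ∧ (4 * h + 2) / 4 = h := by omega
  have h3 : (4 * h + 3) % 4 = 3 ∧ (4 * h + 3) / 4 = h := by omega
  by_cases hm : h < max u.length v.length
  · have e0 : 4 * h + 0 < 4 * max u.length v.length := by omega
    have e1 : 4 * h + 1 < 4 * max u.length v.length := by omega
    have e2 : 4 * h + 2 < 4 * max u.length v.length := by omega
    have e3 : 4 * h + 3 < 4 * max u.length v.length := by omega
    cases b
    · by_cases hu : h < u.length <;>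
        simp [blockTape, blockSymbol, getElem?_pairEnc, pairBit, h1, e1, hu, hm]
    · by_cases hv : h < v.length <;>
        simp [blockTape, blockSymbol, getElem?_pairEnc, pairBit, h2, h3, e2, e3, hv]
  · have e0 : ¬ 4 * h < 4 * max u.length v.length := by omega
    have e2 : ¬ 4 * h + 2 < 4 * max u.length v.length := by omega
    have hu : u.length ≤ h := by omega
    have hv : v.length ≤ h := by omega
    cases b <;> simp [blockTape, blockSymbol, getElem?_pairEnc, e0, e2, hu, hv,
      -mul_lt_mul_iff_right₀]

/-- How far the head has to move back after it has read a block. -/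
def moveBack : HeadMove → ℕ
  | .left => 8
  | .stay => 4
  | .right => 0

theorem moveBack_le (m : HeadMove) : moveBack m ≤ 8 := by cases m <;> simp [moveBack]

/-- A move that has no effect if it is to the left and `e` holds. -/
def clamp (e : Bool) : HeadMove → HeadMove
  | .left => if e then .stay else .left
  | m => m

namespace decode

/-- The states of the machine `decode`. -/
abbrev State (M : RATM 2) : Type := M.State × Fin 16 × (Fin 4 → Option Bool)

/-- The actions of the machine `decode`. -/
abbrev Action (M : RATM 2) : Type :=
  RATMAction (State M) (Fin 2) (Option M.Work) (Option (Bool ⊕ M.Aux))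

/-- The action that enters state `s`, moves the head of input tape `0` by `m`, and on the index tape
of tape `0` and its companion moves by `mi` and writes the bit `e` on the latter. -/
def idle {M : RATM 2} (wk : Option M.Work → Option (Bool ⊕ M.Aux))
    (ix : Fin 2 ⊕ Option M.Work → Bool) (s : State M) (m mi : HeadMove) (e : Bool) : Action M where
  next := s
  write := wk
  writeIndex := fun
    | .inr none => e
    | T => ix T
  move := fun
    | .inl 0 => m
    | _ => .stay
  moveIndex := fun
    | .inl 0 => mi
    | .inr none => mi
    | _ => .stay

/-- The action that corresponds to the action `A` of `M`. -/
def perform {M : RATM 2} (wk : Option M.Work → Option (Bool ⊕ M.Aux))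
    (ix : Fin 2 ⊕ Option M.Work → Bool)
    (A : RATMAction M.State (Fin 2) M.Work (Option (Bool ⊕ M.Aux))) : Action M where
  next := (A.next, 0, fun _ => none)
  write := fun
    | some w => A.write w
    | none => wk none
  writeIndex := fun
    | .inl i => A.writeIndex (.inl i)
    | .inr (some w) => A.writeIndex (.inr w)
    | .inr none => ix (.inr none)
  move := fun
    | .inl 0 => .stay
    | .inl i => A.move (.inl i)
    | .inr (some w) => A.move (.inr w)
    | .inr none => .stay
  moveIndex := fun
    | .inl 0 => clamp (ix (.inr none)) (A.moveIndex (.inl 0))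
    | .inl i => A.moveIndex (.inl i)
    | .inr (some w) => A.moveIndex (.inr w)
    | .inr none => clamp (ix (.inr none)) (A.moveIndex (.inl 0))

/-- The transition function of the machine `decode`. -/
def delta (M : RATM 2) (b : Bool) (s : State M) (inp : Fin 2 → Option Bool)
    (wk : Option M.Work → Option (Bool ⊕ M.Aux)) (ix : Fin 2 ⊕ Option M.Work → Bool) :
    Option (Action M) :=
  let (q, n, r) := s
  if n = 13 then some (idle wk ix (q, 14, r) .stay .right (ix (.inr none)))
  else if n = 14 then some (idle wk ix (q, 15, r) .stay .right (ix (.inr none)))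
  else if n = 15 then some (idle wk ix (q, 0, fun _ => none) .stay .stay true)
  else if h : n.val < 4 then
    some (idle wk ix (q, n + 1, Function.update r ⟨n, h⟩ (inp 0)) .right .stay (ix (.inr none)))
  else (M.δ q (fun i => if i = 0 then blockSymbol b r else inp i) (fun w => wk (some w))
      (fun T => ix (T.map id some))).map fun A =>
    if n.val < 4 + moveBack (A.move (.inl 0)) then
      idle wk ix (q, n + 1, r) .left .stay (ix (.inr none))
    else perform wk ix A

end decode

/-- The machine that runs `M` with the first or second component of argument `0` instead of this
argument.  In state `(q, n, r)` with `n < 4`, it reads cell `n` of the current block; `r` holds the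
cells read so far.  With `4 ≤ n < 13`, it moves the head back and finally takes the action of `M`.
With `13 ≤ n`, it prepares the index tapes.  Index tape `0` is shifted by two cells, so that
addresses are multiplied by four; its left end is marked on the index tape of the work tape
`none`. -/
abbrev decode (M : RATM 2) (b : Bool) : RATM 2 where
  State := decode.State M
  finite_state := by
    have := M.finite_state
    infer_instance
  Work := Option M.Work
  finite_work := by
    have := M.finite_work
    infer_instance
  Aux := M.Aux
  finite_aux := M.finite_aux
  out := some M.out
  start := (M.start, 13, fun _ => none)
  access := (M.access, 0, fun _ => none)
  δ := decode.delta M b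

/-! ### Correctness of the machine that reads one component -/

namespace decode

variable {M : RATM 2} {b : Bool}

/-- The configurations agree, except for the state, input tape `0`, its index tape and the work
tape `none`. -/
structure AgreeBase (c : M.Cfg) (c' : (decode M b).Cfg) : Prop where
  work : ∀ w, c'.work (some w) = c.work w
  index : ∀ w, c'.index (.inr (some w)) = c.index (.inr w)
  index_one : c'.index (.inl 1) = c.index (.inl 1)
  head : ∀ w, c'.head (.inr (some w)) = c.head (.inr w)
  head_one : c'.head (.inl 1) = c.head (.inl 1)
  indexHead : ∀ w, c'.indexHead (.inr (some w)) = c.indexHead (.inr w)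
  indexHead_one : c'.indexHead (.inl 1) = c.indexHead (.inl 1)

/-- The configurations agree, except for the state and the head of input tape `0`. -/
structure Agree (c : M.Cfg) (c' : (decode M b).Cfg) : Prop extends AgreeBase c c' where
  index_zero : c'.index (.inl 0) = (c.index (.inl 0)).map (addRightEmbedding 2)
  index_mark : c'.index (.inr none) = {2}
  indexHead_zero : c'.indexHead (.inl 0) = c.indexHead (.inl 0) + 2
  indexHead_mark : c'.indexHead (.inr none) = c.indexHead (.inl 0) + 2

/-- Each bit gains a factor `2 ^ 2`, so a jump of `M` to a cell becomes a jump to the start of the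
corresponding block at no extra cost. -/
theorem address_shift (s : Finset ℕ) :
    address (s.map (addRightEmbedding 2)) = 4 * address s := by
  simp only [address, Finset.sum_map, addRightEmbedding_apply, pow_add, Finset.mul_sum]
  exact Finset.sum_congr rfl fun _ _ => by ring

theorem setBit_shift (s : Finset ℕ) (h : ℕ) (e : Bool) :
    setBit (s.map (addRightEmbedding 2)) (h + 2) e =
      (setBit s h e).map (addRightEmbedding 2) := by
  cases e
  · simp only [setBit, Bool.false_eq_true, if_false]
    exact (Finset.map_erase (addRightEmbedding 2) s h).symm
  · simp only [setBit, if_true]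
    exact (Finset.map_insert (addRightEmbedding 2) h s).symm

/-- Cell `2` is the image of cell `0` of the original index tape, where a left move has no effect;
the mark in cell `2` tells the machine to suppress it. -/
theorem clamp_apply (m : HeadMove) (h : ℕ) :
    (clamp (decide (h + 2 ∈ ({2} : Finset ℕ))) m).apply (h + 2) = m.apply h + 2 := by
  cases m with
  | left => by_cases h0 : h = 0 <;> simp [clamp, h0, apply_left, apply_stay]; omega
  | stay => rfl
  | right => rfl

/-- The symbols under the heads of the work tapes. -/
abbrev wk (c' : (decode M b).Cfg) : Option M.Work → Option (Bool ⊕ M.Aux) :=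
  fun w => c'.work w (c'.head (.inr w))

/-- The bits under the heads of the index tapes. -/
abbrev ix (c' : (decode M b).Cfg) : Fin 2 ⊕ Option M.Work → Bool :=
  fun T => decide (c'.indexHead T ∈ c'.index T)

variable {X : Fin 2 → ℕ → Option Bool} {c : M.Cfg} {c' : (decode M b).Cfg}

/-- Writing back the symbols just read changes no tape, and `hs` excludes a random access, which
would displace all heads. -/
theorem AgreeBase.idle (hc : AgreeBase c c') {s : State M} (hs : s ≠ (decode M b).access)
    (m mi : HeadMove) (e : Bool) :
    AgreeBase c (act c' (idle (wk c') (ix c') s m mi e)) where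
  work w := (Function.update_eq_self _ _).trans (hc.work w)
  index w := (setBit_self _ _).trans (hc.index w)
  index_one := (setBit_self _ _).trans hc.index_one
  head w := (act_head_of_ne hs _).trans (hc.head w)
  head_one := (act_head_of_ne hs _).trans hc.head_one
  indexHead w := hc.indexHead w
  indexHead_one := hc.indexHead_one

theorem Agree.idle (hc : Agree c c') {s : State M} (hs : s ≠ (decode M b).access)
    (m : HeadMove) : Agree c (act c' (idle (wk c') (ix c') s m .stay (ix c' (.inr none)))) where
  toAgreeBase := hc.toAgreeBase.idle hs _ _ _
  index_zero := (setBit_self _ _).trans hc.index_zero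
  index_mark := (setBit_self _ _).trans hc.index_mark
  indexHead_zero := hc.indexHead_zero
  indexHead_mark := hc.indexHead_mark

theorem read_step (hc : Agree c c') {q : M.State} {n : ℕ} (hn : n < 4)
    {r : Fin 4 → Option Bool} (hs : c'.state = (q, Fin.ofNat 16 n, r)) :
    Agree c ((decode M b).stepT X c') ∧
    ((decode M b).stepT X c').state =
      (q, Fin.ofNat 16 (n + 1), Function.update r ⟨n, hn⟩ (X 0 (c'.head (.inl 0)))) ∧
    ((decode M b).stepT X c').head (.inl 0) = c'.head (.inl 0) + 1 := by
  have hA : (decode M b).actionT X c' = some (idle (wk c') (ix c')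
      (q, Fin.ofNat 16 (n + 1), Function.update r ⟨n, hn⟩ (X 0 (c'.head (.inl 0)))) .right .stay
      (ix c' (.inr none))) := by
    rw [actionT, hs]
    interval_cases n <;> rfl
  rw [stepT_of_some hA]
  -- The access state has counter `0`, whereas the counter here is between `1` and `4`.
  have hne : ((q, Fin.ofNat 16 (n + 1), Function.update r ⟨n, hn⟩ (X 0 (c'.head (.inl 0)))) :
      State M) ≠ (decode M b).access := by
    intro h
    have := congrArg (fun s : State M => s.2.1) h
    interval_cases n <;> simp [Fin.ext_iff] at this
  exact ⟨hc.idle hne _, rfl, act_head_of_ne hne _⟩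

theorem read_block (hc : Agree c c') {q : M.State} (hs : c'.state = (q, 0, fun _ => none)) :
    Agree c (((decode M b).stepT X)^[4] c') ∧
    (((decode M b).stepT X)^[4] c').state = (q, 4, fun k : Fin 4 => X 0 (c'.head (.inl 0) + k)) ∧
    (((decode M b).stepT X)^[4] c').head (.inl 0) = c'.head (.inl 0) + 4 := by
  obtain ⟨h₁, s₁, p₁⟩ := read_step (X := X) hc (n := 0) (by omega) hs
  obtain ⟨h₂, s₂, p₂⟩ := read_step (X := X) h₁ (n := 1) (by omega) s₁
  obtain ⟨h₃, s₃, p₃⟩ := read_step (X := X) h₂ (n := 2) (by omega) s₂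
  obtain ⟨h₄, s₄, p₄⟩ := read_step (X := X) h₃ (n := 3) (by omega) s₃
  refine ⟨h₄, ?_, ?_⟩
  · refine s₄.trans ?_
    rw [p₃, p₂, p₁]
    refine Prod.ext rfl (Prod.ext rfl ?_)
    funext k
    fin_cases k <;> rfl
  · refine p₄.trans ?_
    rw [p₃, p₂, p₁]

/-- The block is kept in `r` and the other tapes are unchanged, so the transition function of `M`
can be consulted anew at every step of the way back; the pending action need not be stored in the
state. -/
theorem actionT_eq (hc : Agree c c') {n : ℕ} (hn : 4 ≤ n) (hn' : n < 13) {r : Fin 4 → Option Bool}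
    (hs : c'.state = (c.state, Fin.ofNat 16 n, r))
    (hr : r = fun k : Fin 4 => X 0 (4 * c.head (.inl 0) + k)) :
    (decode M b).actionT X c' =
      (M.actionT (fun i => if i = 0 then blockTape b (X 0) else X i) c).map fun A =>
        if n < 4 + moveBack (A.move (.inl 0)) then
          idle (wk c') (ix c') (c.state, Fin.ofNat 16 (n + 1), r) .left .stay (ix c' (.inr none))
        else perform (wk c') (ix c') A := by
  have h1 : (fun i : Fin 2 => if i = 0 then blockSymbol b r else X i (c'.head (.inl i))) =
      fun i => (fun i => if i = 0 then blockTape b (X 0) else X i) i (c.head (.inl i)) := by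
    funext i
    fin_cases i
    · simp [hr, blockTape]
    · simp [hc.head_one]
  have h2 : (fun w => c'.work (some w) (c'.head (.inr (some w)))) =
      fun w => c.work w (c.head (.inr w)) := by
    funext w
    rw [hc.work, hc.head]
  have h3 : (fun T : Fin 2 ⊕ M.Work => decide (c'.indexHead (T.map id some) ∈
      c'.index (T.map id some))) = fun T => decide (c.indexHead T ∈ c.index T) := by
    funext T
    rcases T with i | w
    · fin_cases i
      · change decide (c'.indexHead (.inl 0) ∈ c'.index (.inl 0)) = _
        rw [hc.index_zero, hc.indexHead_zero]
        simp
      · change decide (c'.indexHead (.inl 1) ∈ c'.index (.inl 1)) = _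
        rw [hc.index_one, hc.indexHead_one]
        rfl
    · change decide (c'.indexHead (.inr (some w)) ∈ c'.index (.inr (some w))) = _
      rw [hc.index, hc.indexHead]
  rw [actionT, hs]
  simp only [actionT]
  rw [← h1, ← h2, ← h3]
  interval_cases n <;> rfl

theorem back_step (hc : Agree c c') {n : ℕ} (hn : 4 ≤ n) {r : Fin 4 → Option Bool}
    (hs : c'.state = (c.state, Fin.ofNat 16 n, r))
    (hr : r = fun k : Fin 4 => X 0 (4 * c.head (.inl 0) + k))
    {A : RATMAction M.State (Fin 2) M.Work (Option (Bool ⊕ M.Aux))}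
    (hA : M.actionT (fun i => if i = 0 then blockTape b (X 0) else X i) c = some A)
    (hnA : n < 4 + moveBack (A.move (.inl 0))) :
    Agree c ((decode M b).stepT X c') ∧
    ((decode M b).stepT X c').state = (c.state, Fin.ofNat 16 (n + 1), r) ∧
    ((decode M b).stepT X c').head (.inl 0) = c'.head (.inl 0) - 1 := by
  have hle := moveBack_le (A.move (.inl 0))
  have hA' := actionT_eq hc hn (by omega) hs hr
  rw [hA, Option.map_some, if_pos hnA] at hA'
  rw [stepT_of_some hA']
  have hne : ((c.state, Fin.ofNat 16 (n + 1), r) : State M) ≠ (decode M b).access := by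
    intro h
    have := congrArg (fun s : State M => (s.2.1 : ℕ)) h
    simp only [Fin.ofNat, Fin.val_zero] at this
    omega
  exact ⟨hc.idle hne _, rfl, act_head_of_ne hne _⟩

theorem back (hc : Agree c c') {r : Fin 4 → Option Bool}
    (hs : c'.state = (c.state, 4, r))
    (hr : r = fun k : Fin 4 => X 0 (4 * c.head (.inl 0) + k))
    {A : RATMAction M.State (Fin 2) M.Work (Option (Bool ⊕ M.Aux))}
    (hA : M.actionT (fun i => if i = 0 then blockTape b (X 0) else X i) c = some A)
    (m : ℕ) (hm : m ≤ moveBack (A.move (.inl 0))) :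
    Agree c (((decode M b).stepT X)^[m] c') ∧
    (((decode M b).stepT X)^[m] c').state = (c.state, Fin.ofNat 16 (4 + m), r) ∧
    (((decode M b).stepT X)^[m] c').head (.inl 0) = c'.head (.inl 0) - m := by
  induction m with
  | zero => exact ⟨hc, hs, rfl⟩
  | succ m ih =>
    obtain ⟨h₁, s₁, p₁⟩ := ih (by omega)
    rw [Function.iterate_succ_apply']
    obtain ⟨h₂, s₂, p₂⟩ := back_step h₁ (by omega) s₁ hr hA (by omega)
    exact ⟨h₂, s₂, by rw [p₂, p₁]; omega⟩

/-- The configuration `c'` represents the configuration `c` of `M`. -/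
structure Rel (c : M.Cfg) (c' : (decode M b).Cfg) : Prop extends Agree c c' where
  state : c'.state = (c.state, 0, fun _ => none)
  head_zero : c'.head (.inl 0) = 4 * c.head (.inl 0)

/-- Both machines jump in the same step or neither does. In a jump, the shifted index tape supplies
four times the address; otherwise `hh` says that the head is already at the start of the new block.
-/
theorem perform_rel (hc : Agree c c')
    (A : RATMAction M.State (Fin 2) M.Work (Option (Bool ⊕ M.Aux)))
    (hh : c'.head (.inl 0) = 4 * (A.move (.inl 0)).apply (c.head (.inl 0))) :
    Rel (act c A) (act c' (perform (wk c') (ix c') A)) := by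
  have hw : ∀ w, (act c' (perform (wk c') (ix c') A)).index (.inr (some w)) =
      (act c A).index (.inr w) := fun w => by
    rw [act_index, act_index, hc.index, hc.indexHead]; rfl
  have h1 : (act c' (perform (wk c') (ix c') A)).index (.inl 1) = (act c A).index (.inl 1) := by
    rw [act_index, act_index, hc.index_one, hc.indexHead_one]; rfl
  have h0 : (act c' (perform (wk c') (ix c') A)).index (.inl 0) =
      ((act c A).index (.inl 0)).map (addRightEmbedding 2) := by
    rw [act_index, act_index, hc.index_zero, hc.indexHead_zero, ← setBit_shift]; rfl
  have hhead : (∀ w, (act c' (perform (wk c') (ix c') A)).head (.inr (some w)) =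
        (act c A).head (.inr w)) ∧
      (act c' (perform (wk c') (ix c') A)).head (.inl 1) = (act c A).head (.inl 1) ∧
      (act c' (perform (wk c') (ix c') A)).head (.inl 0) = 4 * (act c A).head (.inl 0) := by
    by_cases hn : A.next = M.access
    · have hn' : (perform (wk c') (ix c') A).next = (decode M b).access := by
        simp [perform, hn]
      refine ⟨fun w => ?_, ?_, ?_⟩
      · rw [act_head_of_eq hn, act_head_of_eq hn']
        exact congrArg address (hw w)
      · rw [act_head_of_eq hn, act_head_of_eq hn']
        exact congrArg address h1
      · rw [act_head_of_eq hn, act_head_of_eq hn', ← address_shift]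
        exact congrArg address h0
    · have hn' : (perform (wk c') (ix c') A).next ≠ (decode M b).access := by
        simp [perform, hn]
      refine ⟨fun w => ?_, ?_, ?_⟩
      · rw [act_head_of_ne hn, act_head_of_ne hn', hc.head]; rfl
      · rw [act_head_of_ne hn, act_head_of_ne hn', hc.head_one]; rfl
      · rw [act_head_of_ne hn, act_head_of_ne hn', ← hh]; rfl
  have hmark : (clamp (ix c' (.inr none)) (A.moveIndex (.inl 0))).apply
      (c.indexHead (.inl 0) + 2) = (act c A).indexHead (.inl 0) + 2 := by
    simp only [ix, hc.index_mark, hc.indexHead_mark]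
    exact clamp_apply _ _
  exact {
    work := fun w => by rw [act_work, act_work, hc.work, hc.head]; rfl
    index := hw
    index_one := h1
    index_zero := h0
    index_mark := (setBit_self _ _).trans hc.index_mark
    head := hhead.1
    head_one := hhead.2.1
    head_zero := hhead.2.2
    indexHead := fun w => by rw [act_indexHead, act_indexHead, hc.indexHead]; rfl
    indexHead_one := by rw [act_indexHead, act_indexHead, hc.indexHead_one]; rfl
    indexHead_zero := by rw [act_indexHead, hc.indexHead_zero]; exact hmark
    indexHead_mark := by rw [act_indexHead, hc.indexHead_mark]; exact hmark
    state := rfl }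

theorem Rel.step (hc : Rel c c')
    {A : RATMAction M.State (Fin 2) M.Work (Option (Bool ⊕ M.Aux))}
    (hA : M.actionT (fun i => if i = 0 then blockTape b (X 0) else X i) c = some A) :
    ∃ s, s ≤ 13 ∧ Rel (act c A) (((decode M b).stepT X)^[s] c') := by
  obtain ⟨h₁, s₁, p₁⟩ := read_block (X := X) hc.toAgree hc.state
  rw [hc.head_zero] at s₁ p₁
  obtain ⟨h₂, s₂, p₂⟩ := back h₁ s₁ rfl hA _ le_rfl
  have hle := moveBack_le (A.move (.inl 0))
  have hA' := actionT_eq h₂ (by omega) (by omega) s₂ rfl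
  rw [hA, Option.map_some, if_neg (lt_irrefl _)] at hA'
  -- Four steps of reading, at most eight of moving back, and one for the action.
  refine ⟨(moveBack (A.move (.inl 0)) + 4) + 1, by omega, ?_⟩
  rw [Function.iterate_succ_apply', Function.iterate_add_apply, stepT_of_some hA']
  refine perform_rel h₂ A ?_
  rw [p₂, p₁]
  -- Reading a block `h` leaves the head at `4 * h + 4`. For a left move with `h = 0`, moving back
  -- by `8` is cut off at cell `0`, as it should be.
  cases A.move (.inl 0) <;> simp only [moveBack, apply_left, apply_right, apply_stay] <;> omega

theorem prepare_step (hc : AgreeBase c c') {q : M.State} {n : ℕ} (hn : n = 13 ∨ n = 14)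
    {r : Fin 4 → Option Bool} {h : ℕ} (hs : c'.state = (q, Fin.ofNat 16 n, r))
    (h0 : c'.index (.inl 0) = ∅) (hm : c'.index (.inr none) = ∅)
    (p0 : c'.indexHead (.inl 0) = h) (pm : c'.indexHead (.inr none) = h) :
    AgreeBase c ((decode M b).stepT X c') ∧
    ((decode M b).stepT X c').state = (q, Fin.ofNat 16 (n + 1), r) ∧
    ((decode M b).stepT X c').index (.inl 0) = ∅ ∧
    ((decode M b).stepT X c').index (.inr none) = ∅ ∧
    ((decode M b).stepT X c').indexHead (.inl 0) = h + 1 ∧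
    ((decode M b).stepT X c').indexHead (.inr none) = h + 1 ∧
    ((decode M b).stepT X c').head (.inl 0) = c'.head (.inl 0) := by
  have hA : (decode M b).actionT X c' = some (idle (wk c') (ix c')
      (q, Fin.ofNat 16 (n + 1), r) .stay .right (ix c' (.inr none))) := by
    rw [actionT, hs]
    rcases hn with rfl | rfl <;> rfl
  rw [stepT_of_some hA]
  have hne : ((q, Fin.ofNat 16 (n + 1), r) : State M) ≠ (decode M b).access := by
    intro h
    have := congrArg (fun s : State M => s.2.1) h
    rcases hn with rfl | rfl <;> simp [Fin.ext_iff] at this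
  exact ⟨hc.idle hne _ _ _, rfl, (setBit_self _ _).trans h0, (setBit_self _ _).trans hm,
    congrArg (· + 1) p0, congrArg (· + 1) pm, act_head_of_ne hne _⟩

theorem rel_init : Rel M.init (((decode M b).stepT X)^[3] (decode M b).init) := by
  have h₀ : AgreeBase M.init (decode M b).init :=
    ⟨fun _ => rfl, fun _ => rfl, rfl, fun _ => rfl, rfl, fun _ => rfl, rfl⟩
  obtain ⟨h₁, s₁, i₁, m₁, p₁, q₁, e₁⟩ := prepare_step (X := X) h₀ (n := 13) (by omega) rfl rfl rfl
    (h := 0) rfl rfl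
  obtain ⟨h₂, s₂, i₂, m₂, p₂, q₂, e₂⟩ := prepare_step (X := X) h₁ (n := 14) (by omega) s₁ i₁ m₁
    p₁ q₁
  change Rel M.init ((decode M b).stepT X ((decode M b).stepT X
    ((decode M b).stepT X (decode M b).init)))
  generalize (decode M b).stepT X ((decode M b).stepT X (decode M b).init) = c' at *
  have hA : (decode M b).actionT X c' = some (idle (wk c') (ix c')
      (M.start, 0, fun _ => none) .stay .stay true) := by
    rw [actionT, s₂]
    rfl
  rw [stepT_of_some hA]
  have hhead : ∀ T, T ≠ .inr none → c'.head T = 0 → c'.index T = ∅ →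
      (act c' (idle (wk c') (ix c') (M.start, 0, fun _ => none) .stay .stay true)).head T = 0 := by
    intro T hT h₁ h₂
    -- The start state of `M` may be its access state. The jump is then harmless, since the relevant
    -- index tapes hold `0`.
    by_cases hs : (M.start, 0, fun _ => none) = (decode M b).access
    · rw [act_head_of_eq hs]
      refine (congrArg address ((?_ : _ = c'.index T).trans h₂)).trans address_empty
      rcases T with i | _ | w
      · exact setBit_self _ _
      · exact absurd rfl hT
      · exact setBit_self _ _
    · rw [act_head_of_ne hs]
      rcases T with i | _ | w
      · fin_cases i <;> exact h₁
      · exact absurd rfl hT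
      · exact h₁
  exact {
    work := fun w => (Function.update_eq_self _ _).trans (h₂.work w)
    index := fun w => (setBit_self _ _).trans (h₂.index w)
    index_one := (setBit_self _ _).trans h₂.index_one
    index_zero := (setBit_self _ _).trans i₂
    index_mark := by
      rw [act_index, m₂, q₂]
      rfl
    head := fun w => hhead _ (by simp) (h₂.head w) (h₂.index w)
    head_one := hhead _ (by simp) h₂.head_one h₂.index_one
    head_zero := hhead _ (by simp) (e₂.trans e₁) i₂
    indexHead := h₂.indexHead
    indexHead_one := h₂.indexHead_one
    indexHead_zero := p₂
    indexHead_mark := q₂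
    state := rfl }

theorem haltsWith {t : ℕ} {Y : ℕ → Option (Bool ⊕ M.Aux)}
    (h : M.HaltsWith (fun i => if i = 0 then blockTape b (X 0) else X i) t Y) :
    (decode M b).HaltsWith X (13 * t + 7) Y := by
  obtain ⟨j, -, s, hs, hR⟩ := simulate (R := fun _ => Rel) (T := t) (K := 13)
    (fun i _ c c' A hc hA => hc.step hA) t 0 (by omega) (rel_init (X := X) (b := b) (M := M))
  have h₁ := read_block (X := X) hR.toAgree hR.state
  rw [hR.head_zero] at h₁
  have h₂ := actionT_eq h₁.1 (n := 4) (by omega) (by omega) h₁.2.1 rfl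
  rw [h.1, Option.map_none, ← Function.iterate_add_apply, ← Function.iterate_add_apply] at h₂
  -- Three steps prepare the index tapes; at the end, four more read the block before it becomes
  -- known that `M` halts.
  refine HaltsWith.mono (t := 4 + (s + 3)) ⟨h₂, ?_⟩ (by omega)
  rw [Function.iterate_add_apply, Function.iterate_add_apply]
  exact (h₁.1.work _).trans h.2

theorem haltsWith_pairEnc {u v P : List Bool} {t : ℕ} {Y : ℕ → Option (Bool ⊕ M.Aux)}
    (h : M.HaltsWith (tapes ![if b then v else u, P]) t Y) :
    (decode M b).HaltsWith (tapes ![pairEnc u v, P]) (13 * t + 7) Y := by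
  refine haltsWith ?_
  convert h using 1
  funext i
  fin_cases i
  · exact blockTape_pairEnc b u v
  · rfl

end decode

end RATM

/-! ### Composition of machines -/

namespace RATM

/-- The bit that a symbol of a work tape represents. -/
def bitOf {A : Type} : Option (Bool ⊕ A) → Option Bool
  | some (.inl e) => some e
  | _ => none

namespace compose

variable {M₁ M₂ : RATM 2}

/-- Symbols of the first machine. -/
def emb₁ {A B : Type} : Option (Bool ⊕ A) → Option (Bool ⊕ (A ⊕ B)) := Option.map (Sum.map id .inl)

/-- Symbols of the second machine. -/
def emb₂ {A B : Type} : Option (Bool ⊕ B) → Option (Bool ⊕ (A ⊕ B)) := Option.map (Sum.map id .inr)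

/-- Left inverse of `emb₁`. -/
def proj₁ {A B : Type} : Option (Bool ⊕ (A ⊕ B)) → Option (Bool ⊕ A)
  | some (.inl e) => some (.inl e)
  | some (.inr (.inl s)) => some (.inr s)
  | _ => none

/-- Left inverse of `emb₂`. -/
def proj₂ {A B : Type} : Option (Bool ⊕ (A ⊕ B)) → Option (Bool ⊕ B)
  | some (.inl e) => some (.inl e)
  | some (.inr (.inr s)) => some (.inr s)
  | _ => none

theorem proj₁_emb₁ {A B : Type} (s : Option (Bool ⊕ A)) : proj₁ (emb₁ (B := B) s) = s := by
  rcases s with _ | _ | _ <;> rfl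

theorem proj₂_emb₂ {A B : Type} (s : Option (Bool ⊕ B)) : proj₂ (emb₂ (A := A) s) = s := by
  rcases s with _ | _ | _ <;> rfl

theorem bitOf_emb₁ {A B : Type} (s : Option (Bool ⊕ A)) : bitOf (emb₁ (B := B) s) = bitOf s := by
  rcases s with _ | _ | _ <;> rfl

/-- The tapes of a machine. -/
abbrev Tape (M : RATM 2) : Type := Fin 2 ⊕ M.Work

/-- The work tapes: those of the two machines, two for each tape of the first machine, and two
more.  Of the tapes other than those of the machines, only the index tapes are used. -/
abbrev Work (M₁ M₂ : RATM 2) : Type := M₁.Work ⊕ M₂.Work ⊕ Tape M₁ ⊕ Tape M₁ ⊕ Bool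

/-- The states of the composed machine. -/
abbrev State (M₁ M₂ : RATM 2) : Type := M₁.State × M₂.State × Fin 4

/-- The work symbols of the composed machine. -/
abbrev Sym (M₁ M₂ : RATM 2) : Type := Option (Bool ⊕ (M₁.Aux ⊕ M₂.Aux))

/-- The actions of the composed machine. -/
abbrev Action (M₁ M₂ : RATM 2) : Type :=
  RATMAction (State M₁ M₂) (Fin 2) (Work M₁ M₂) (Sym M₁ M₂)

/-- The tapes of the first machine. -/
abbrev fst : Tape M₁ → Fin 2 ⊕ Work M₁ M₂
  | .inl i => .inl i
  | .inr w => .inr (.inl w)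

/-- The tapes of the second machine; its input tape `1` is the output tape of the first machine. -/
abbrev snd : Tape M₂ → Fin 2 ⊕ Work M₁ M₂
  | .inl 0 => .inl 0
  | .inl 1 => .inr (.inl M₁.out)
  | .inr w => .inr (.inr (.inl w))

/-- The tape whose index tape marks the left end of the index tape of `T`. -/
abbrev mark (T : Tape M₁) : Fin 2 ⊕ Work M₁ M₂ := .inr (.inr (.inr (.inl T)))

/-- The tape whose index tape marks the cells of the index tape of `T` that have been visited. -/
abbrev visited (T : Tape M₁) : Fin 2 ⊕ Work M₁ M₂ := .inr (.inr (.inr (.inr (.inl T))))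

/-- The tapes whose index tapes tell in their cells `0` whether the first machine has finished
(`false`) and whether the second machine has been started (`true`). -/
abbrev flag (e : Bool) : Fin 2 ⊕ Work M₁ M₂ := .inr (.inr (.inr (.inr (.inr e))))

open Classical in
/-- Partial inverse of `snd`. -/
noncomputable def sndInv : Fin 2 ⊕ Work M₁ M₂ → Option (Tape M₂)
  | .inl 0 => some (.inl 0)
  | .inl 1 => none
  | .inr (.inl w) => if w = M₁.out then some (.inl 1) else none
  | .inr (.inr (.inl w)) => some (.inr w)
  | .inr (.inr (.inr _)) => none

theorem sndInv_snd (T : Tape M₂) : sndInv (snd T : Fin 2 ⊕ Work M₁ M₂) = some T := by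
  rcases T with i | w
  · fin_cases i
    · rfl
    · simp [sndInv]
  · rfl

/-- The action that enters state `s`, moves all index heads of the first machine by `m`, and writes
`wf`, `wm` and `e` on the index tapes of the first machine, on the marking tapes and on the
flags. -/
def control (wk : Work M₁ M₂ → Sym M₁ M₂) (ix : Fin 2 ⊕ Work M₁ M₂ → Bool) (s : State M₁ M₂)
    (m : HeadMove) (wf wm : Tape M₁ → Bool) (e : Bool → Bool) : Action M₁ M₂ where
  next := s
  write := wk
  writeIndex := fun
    | .inl i => wf (.inl i)
    | .inr (.inl w) => wf (.inr w)
    | .inr (.inr (.inl w)) => ix (.inr (.inr (.inl w)))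
    | .inr (.inr (.inr (.inl T))) => wm T
    | .inr (.inr (.inr (.inr (.inl T)))) => ix (visited T)
    | .inr (.inr (.inr (.inr (.inr b)))) => e b
  move := fun _ => .stay
  moveIndex := fun
    | .inl _ => m
    | .inr (.inl _) => m
    | .inr (.inr (.inl _)) => .stay
    | .inr (.inr (.inr (.inl _))) => m
    | .inr (.inr (.inr (.inr (.inl _)))) => m
    | .inr (.inr (.inr (.inr (.inr _)))) => .stay

/-- The action that corresponds to the action `A` of the first machine. -/
def perform₁ (wk : Work M₁ M₂ → Sym M₁ M₂) (ix : Fin 2 ⊕ Work M₁ M₂ → Bool)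
    (A : RATMAction M₁.State (Fin 2) M₁.Work (Option (Bool ⊕ M₁.Aux))) : Action M₁ M₂ where
  next := (A.next, M₂.access, 0)
  write := fun
    | .inl w => emb₁ (A.write w)
    | .inr w => wk (.inr w)
  writeIndex := fun
    | .inl i => A.writeIndex (.inl i)
    | .inr (.inl w) => A.writeIndex (.inr w)
    | .inr (.inr (.inr (.inr (.inl _)))) => true
    | T => ix T
  move := fun
    | .inl i => A.move (.inl i)
    | .inr (.inl w) => A.move (.inr w)
    | _ => .stay
  moveIndex := fun
    | .inl i => A.moveIndex (.inl i)
    | .inr (.inl w) => A.moveIndex (.inr w)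
    | .inr (.inr (.inl _)) => .stay
    | .inr (.inr (.inr (.inl T))) => A.moveIndex T
    | .inr (.inr (.inr (.inr (.inl T)))) => A.moveIndex T
    | .inr (.inr (.inr (.inr (.inr _)))) => .stay

/-- The action that corresponds to the action `A` of the second machine. -/
noncomputable def perform₂ (wk : Work M₁ M₂ → Sym M₁ M₂) (ix : Fin 2 ⊕ Work M₁ M₂ → Bool)
    (A : RATMAction M₂.State (Fin 2) M₂.Work (Option (Bool ⊕ M₂.Aux))) : Action M₁ M₂ where
  next := (M₁.access, A.next, 0)
  write := fun
    | .inr (.inl w) => emb₂ (A.write w)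
    | w => wk w
  writeIndex := fun T => (sndInv T).elim (ix T) A.writeIndex
  move := fun T => (sndInv T).elim .stay A.move
  moveIndex := fun T => (sndInv T).elim .stay A.moveIndex

open Classical in
/-- The transition function of the composed machine. -/
noncomputable def delta (M₁ M₂ : RATM 2) (s : State M₁ M₂) (inp : Fin 2 → Option Bool)
    (wk : Work M₁ M₂ → Sym M₁ M₂) (ix : Fin 2 ⊕ Work M₁ M₂ → Bool) : Option (Action M₁ M₂) :=
  if s.2.2 = 1 then
    some (control wk ix (M₁.start, M₂.access, 0) .stay (fun T => ix (fst T)) (fun _ => true)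
      (fun e => ix (flag e)))
  else if s.2.2 = 2 then
    if ∀ T, ix (visited T) = false then
      some (control wk ix (s.1, s.2.1, 3) .stay (fun T => ix (fst T)) (fun T => ix (mark T))
        (fun e => ix (flag e)))
    else some (control wk ix (s.1, s.2.1, 2) .right (fun T => ix (fst T)) (fun T => ix (mark T))
        (fun e => ix (flag e)))
  else if s.2.2 = 3 then
    if ∀ T, ix (mark T) = true then
      some (control wk ix (M₁.access, M₂.access, 0) .stay (fun _ => false) (fun T => ix (mark T))
        (fun e => !e))
    else some (control wk ix (s.1, s.2.1, 3) .left (fun _ => false) (fun T => ix (mark T))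
        (fun e => ix (flag e)))
  else if ix (flag false) = false then
    some ((M₁.δ s.1 inp (fun w => proj₁ (wk (.inl w))) (fun T => ix (fst T))).elim
      (control wk ix (s.1, s.2.1, 2) .stay (fun T => ix (fst T)) (fun T => ix (mark T))
        (fun e => ix (flag e)))
      (perform₁ wk ix))
  else if ix (flag true) = false then
    some (control wk ix (M₁.access, M₂.start, 0) .stay (fun T => ix (fst T)) (fun T => ix (mark T))
      (fun _ => true))
  else
    (M₂.δ s.2.1 (fun i => if i = 0 then inp 0 else bitOf (wk (.inl M₁.out)))
      (fun w => proj₂ (wk (.inr (.inl w)))) (fun T => ix (snd T))).map (perform₂ wk ix)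

end compose

/-- The machine that runs `M₁` and then runs `M₂` on argument `0` and the output of `M₁`.  In
between, it erases the index tapes of `M₁` and moves all heads back to cell `0`.  In mode `1` of its
states, it marks the left ends of the index tapes, in mode `2` it moves the index heads past all
cells visited, in mode `3` it moves them back, and in mode `0` it simulates one of the machines. -/
noncomputable abbrev compose (M₁ M₂ : RATM 2) : RATM 2 where
  State := compose.State M₁ M₂
  finite_state := by
    have := M₁.finite_state
    have := M₂.finite_state
    infer_instance
  Work := compose.Work M₁ M₂
  finite_work := by
    have := M₁.finite_work
    have := M₂.finite_work
    infer_instance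
  Aux := M₁.Aux ⊕ M₂.Aux
  finite_aux := by
    have := M₁.finite_aux
    have := M₂.finite_aux
    infer_instance
  out := .inr (.inl M₂.out)
  start := (M₁.start, M₂.access, 1)
  access := (M₁.access, M₂.access, 0)
  δ := compose.delta M₁ M₂

/-! ### Correctness of the composed machine -/

namespace compose

variable {M₁ M₂ : RATM 2} {X : Fin 2 → ℕ → Option Bool} {c' : (compose M₁ M₂).Cfg}

/-- The symbols under the heads of the work tapes. -/
abbrev wk (c' : (compose M₁ M₂).Cfg) : Work M₁ M₂ → Sym M₁ M₂ :=
  fun w => c'.work w (c'.head (.inr w))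

/-- The bits under the heads of the index tapes. -/
abbrev ix (c' : (compose M₁ M₂).Cfg) : Fin 2 ⊕ Work M₁ M₂ → Bool :=
  fun T => decide (c'.indexHead T ∈ c'.index T)

/-- The tapes of the second machine are as in its initial configuration, the index heads of the
flags are on cell `0`, and the marking tapes and the index heads are consistent; `n T` cells of
the index tape of `T` have been visited. -/
structure Base (n : Tape M₁ → ℕ) (c' : (compose M₁ M₂).Cfg) : Prop where
  work₂ : ∀ w, c'.work (.inr (.inl w)) = fun _ => none
  index₂ : ∀ w, c'.index (.inr (.inr (.inl w))) = ∅
  head₂ : ∀ w, c'.head (.inr (.inr (.inl w))) = 0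
  indexHead₂ : ∀ w, c'.indexHead (.inr (.inr (.inl w))) = 0
  indexHead_flag : ∀ e, c'.indexHead (flag e) = 0
  index_mark : ∀ T, c'.index (mark T) = {0}
  index_visited : ∀ T, c'.index (visited T) = Finset.range (n T)
  indexHead_mark : ∀ T, c'.indexHead (mark T) = c'.indexHead (fst T)
  indexHead_visited : ∀ T, c'.indexHead (visited T) = c'.indexHead (fst T)

/-- The configuration `c'` represents the configuration `c` of the first machine, after at most `i`
steps. -/
structure Rel₁ (i : ℕ) (c : M₁.Cfg) (c' : (compose M₁ M₂).Cfg) : Prop where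
  base : ∃ n : Tape M₁ → ℕ, Base n c' ∧
    ∀ T, n T ≤ i ∧ c'.indexHead (fst T) ≤ n T ∧ c'.index (fst T) ⊆ Finset.range (n T)
  state : c'.state = (c.state, M₂.access, 0)
  work : ∀ w, c'.work (.inl w) = fun j => emb₁ (c.work w j)
  index : ∀ T, c'.index (fst T) = c.index T
  head : ∀ T, c'.head (fst T) = c.head T
  indexHead : ∀ T, c'.indexHead (fst T) = c.indexHead T
  index_flag : ∀ e, c'.index (flag e) = ∅

theorem control_base {n : Tape M₁ → ℕ} (hc : Base n c') (s : State M₁ M₂) (m : HeadMove)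
    (wf : Tape M₁ → Bool) (e : Bool → Bool) :
    Base n (act c' (control (wk c') (ix c') s m wf (fun T => ix c' (mark T)) e)) where
  work₂ w := (Function.update_eq_self _ _).trans (hc.work₂ w)
  index₂ w := (setBit_self _ _).trans (hc.index₂ w)
  head₂ w := by
    by_cases hs : s = (compose M₁ M₂).access
    · rw [act_head_of_eq hs]
      exact (congrArg address ((setBit_self _ _).trans (hc.index₂ w))).trans address_empty
    · rw [act_head_of_ne hs]
      exact hc.head₂ w
  indexHead₂ := hc.indexHead₂
  indexHead_flag := hc.indexHead_flag
  index_mark T := (setBit_self _ _).trans (hc.index_mark T)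
  index_visited T := (setBit_self _ _).trans (hc.index_visited T)
  indexHead_mark T := by
    rw [act_indexHead, hc.indexHead_mark]
    rcases T with i | w <;> rfl
  indexHead_visited T := by
    rw [act_indexHead, hc.indexHead_visited]
    rcases T with i | w <;> rfl

theorem control_work (s : State M₁ M₂) (m : HeadMove) (wf wm : Tape M₁ → Bool)
    (e : Bool → Bool) (w : Work M₁ M₂) :
    (act c' (control (wk c') (ix c') s m wf wm e)).work w = c'.work w :=
  Function.update_eq_self _ _

theorem control_index (s : State M₁ M₂) (m : HeadMove) (wf wm : Tape M₁ → Bool)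
    (e : Bool → Bool) (T : Tape M₁) :
    (act c' (control (wk c') (ix c') s m wf wm e)).index (fst T) =
      setBit (c'.index (fst T)) (c'.indexHead (fst T)) (wf T) := by
  rcases T with i | w <;> rfl

theorem control_indexHead (s : State M₁ M₂) (m : HeadMove) (wf wm : Tape M₁ → Bool)
    (e : Bool → Bool) (T : Tape M₁) :
    (act c' (control (wk c') (ix c') s m wf wm e)).indexHead (fst T) =
      m.apply (c'.indexHead (fst T)) := by
  rcases T with i | w <;> rfl

/-- An index head starts in cell `0` and moves by at most one cell, so the visited cells always form
an initial segment. -/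
theorem insert_range {n p : ℕ} (h : p ≤ n) :
    insert p (Finset.range n) = Finset.range (max n (p + 1)) := by
  ext j
  simp only [Finset.mem_insert, Finset.mem_range]
  omega

/-- The second state component is kept equal to `M₂.access`, so the composed machine jumps exactly
when the first machine does. The jump also affects the tapes of the second machine, but their index
tapes are empty and their heads stay on cell `0`. -/
theorem perform₁_rel {i : ℕ} {c : M₁.Cfg} (hc : Rel₁ i c c')
    (A : RATMAction M₁.State (Fin 2) M₁.Work (Option (Bool ⊕ M₁.Aux))) :
    Rel₁ (i + 1) (act c A) (act c' (perform₁ (wk c') (ix c') A)) := by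
  obtain ⟨n, hb, hn⟩ := hc.base
  have hnext : (perform₁ (wk c') (ix c') A).next = (compose M₁ M₂).access ↔
      A.next = M₁.access := by
    simp [perform₁]
  have hindex : ∀ T, (act c' (perform₁ (wk c') (ix c') A)).index (fst T) = (act c A).index T := by
    intro T
    rw [act_index, act_index, hc.index, hc.indexHead]
    rcases T with i | w <;> rfl
  have hhead : ∀ T, (act c' (perform₁ (wk c') (ix c') A)).indexHead (fst T) =
      (A.moveIndex T).apply (c'.indexHead (fst T)) := by
    rintro (i | w) <;> rfl
  refine ⟨⟨fun T => max (n T) (c'.indexHead (fst T) + 1), ?_, fun T => ?_⟩, rfl, fun w => ?_,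
    hindex, fun T => ?_, fun T => ?_, fun e => (setBit_self _ _).trans (hc.index_flag e)⟩
  · exact {
      work₂ := fun w => (Function.update_eq_self _ _).trans (hb.work₂ w)
      index₂ := fun w => (setBit_self _ _).trans (hb.index₂ w)
      head₂ := fun w => by
        by_cases hs : A.next = M₁.access
        · rw [act_head_of_eq (hnext.2 hs)]
          exact (congrArg address ((setBit_self _ _).trans (hb.index₂ w))).trans address_empty
        · rw [act_head_of_ne (mt hnext.1 hs)]
          exact hb.head₂ w
      indexHead₂ := hb.indexHead₂
      indexHead_flag := hb.indexHead_flag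
      index_mark := fun T => (setBit_self _ _).trans (hb.index_mark T)
      index_visited := fun T => by
        rw [act_index, hb.index_visited, hb.indexHead_visited]
        exact insert_range (hn T).2.1
      indexHead_mark := fun T => by
        rw [act_indexHead, hb.indexHead_mark, hhead]; rfl
      indexHead_visited := fun T => by
        rw [act_indexHead, hb.indexHead_visited, hhead]; rfl }
  · obtain ⟨h₁, h₂, h₃⟩ := hn T
    refine ⟨max_le (by omega) (by omega), ?_, ?_⟩
    · rw [hhead]
      exact (move_apply_le _ _).trans (le_max_right _ _)
    · have : ∀ e, setBit (c'.index (fst T)) (c'.indexHead (fst T)) e ⊆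
          Finset.range (max (n T) (c'.indexHead (fst T) + 1)) := by
        intro e
        rw [← insert_range h₂]
        cases e
        · exact (Finset.erase_subset _ _).trans (h₃.trans (Finset.subset_insert _ _))
        · exact Finset.insert_subset_insert _ h₃
      exact this _
  · rw [act_work, act_work, hc.work]
    have := hc.head (.inr w)
    rw [this]
    exact (Function.comp_update emb₁ (c.work w) _ _).symm
  · by_cases hs : A.next = M₁.access
    · rw [act_head_of_eq hs, act_head_of_eq (hnext.2 hs)]
      exact congrArg address (hindex T)
    · rw [act_head_of_ne hs, act_head_of_ne (mt hnext.1 hs), hc.head]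
      rcases T with i | w <;> rfl
  · rw [hhead, hc.indexHead, act_indexHead]

/-- There is only one access state and both phases pass through it, so the state cannot record which
machine is running; the flags on tape do. -/
theorem actionT_sim₁ {i : ℕ} {c : M₁.Cfg} (hc : Rel₁ i c c') :
    (compose M₁ M₂).actionT X c' = some ((M₁.actionT X c).elim
      (control (wk c') (ix c') (c.state, M₂.access, 2) .stay (fun T => ix c' (fst T))
        (fun T => ix c' (mark T)) (fun e => ix c' (flag e)))
      (perform₁ (wk c') (ix c'))) := by
  have hflag : ix c' (flag false) = false := by simp only [ix, hc.index_flag]; rfl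
  have h1 : (fun i : Fin 2 => X i (c'.head (.inl i))) = fun i => X i (c.head (.inl i)) :=
    funext fun i => by rw [← hc.head (.inl i)]
  have h2 : (fun w => proj₁ (wk c' (.inl w))) = fun w => c.work w (c.head (.inr w)) :=
    funext fun w => by
      have := hc.head (.inr w)
      simp only [wk, hc.work, this, proj₁_emb₁]
  have h3 : (fun T => ix c' (fst T)) = fun T => decide (c.indexHead T ∈ c.index T) :=
    funext fun T => by simp only [ix, hc.index, hc.indexHead]
  change delta M₁ M₂ c'.state (fun i => X i (c'.head (.inl i))) (wk c') (ix c') = _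
  rw [hc.state, h1]
  simp only [delta, hflag, if_true, h2, h3]
  rfl

theorem Rel₁.step {i : ℕ} {c : M₁.Cfg} (hc : Rel₁ i c c')
    {A : RATMAction M₁.State (Fin 2) M₁.Work (Option (Bool ⊕ M₁.Aux))}
    (hA : M₁.actionT X c = some A) : Rel₁ (i + 1) (act c A) ((compose M₁ M₂).stepT X c') := by
  have h := actionT_sim₁ (X := X) hc
  rw [hA, Option.elim_some] at h
  rw [stepT_of_some h]
  exact perform₁_rel hc A

theorem rel₁_init : Rel₁ 0 M₁.init ((compose M₁ M₂).stepT X (compose M₁ M₂).init) := by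
  set c' := (compose M₁ M₂).init
  have hA : (compose M₁ M₂).actionT X c' = some (control (wk c') (ix c') (M₁.start, M₂.access, 0)
      .stay (fun T => ix c' (fst T)) (fun _ => true) (fun e => ix c' (flag e))) := rfl
  rw [stepT_of_some hA]
  set A := control (wk c') (ix c') (M₁.start, M₂.access, 0) .stay (fun T => ix c' (fst T))
    (fun _ => true) (fun e => ix c' (flag e)) with hA
  have hhead : ∀ T, (act c' A).index T = ∅ → (act c' A).head T = 0 := by
    intro T hT
    by_cases hs : (M₁.start, M₂.access, 0) = (compose M₁ M₂).access
    · rw [act_head_of_eq hs]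
      exact (congrArg address hT).trans address_empty
    · rw [act_head_of_ne hs]
      rfl
  have hfst : ∀ T, (act c' A).index (fst T) = ∅ := by
    intro T
    rw [hA, control_index]
    exact setBit_self _ _
  have hfst' : ∀ T, (act c' A).indexHead (fst T) = 0 := by
    intro T
    rw [hA, control_indexHead]
    rcases T with i | w <;> rfl
  refine ⟨⟨fun _ => 0, ?_, fun T => ?_⟩, rfl, fun w => ?_, hfst, fun T => hhead _ (hfst T), hfst',
    fun e => setBit_self ∅ 0⟩
  · exact {
      work₂ := fun w => Function.update_eq_self _ _
      index₂ := fun w => setBit_self ∅ 0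
      head₂ := fun w => hhead _ (setBit_self ∅ 0)
      indexHead₂ := fun w => rfl
      indexHead_flag := fun e => rfl
      index_mark := fun T => rfl
      index_visited := fun T => setBit_self ∅ 0
      indexHead_mark := fun T => (hfst' T).symm
      indexHead_visited := fun T => (hfst' T).symm }
  · rw [hfst, hfst']
    exact ⟨le_rfl, le_rfl, Finset.empty_subset _⟩
  · exact Function.update_eq_self _ _

/-- The configuration in mode `m` in which `Y` is on the output tape of the first machine. -/
structure Walk (m : Fin 4) (Y : ℕ → Option (Bool ⊕ M₁.Aux)) (n : Tape M₁ → ℕ)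
    (c' : (compose M₁ M₂).Cfg) : Prop extends Base n c' where
  mode : c'.state.2.2 = m
  work : c'.work (.inl M₁.out) = fun j => emb₁ (Y j)
  index_flag : ∀ e, c'.index (flag e) = ∅

theorem control_walk {m : Fin 4} {Y : ℕ → Option (Bool ⊕ M₁.Aux)} {n : Tape M₁ → ℕ}
    (hc : Walk m Y n c') (s : State M₁ M₂) (mv : HeadMove) (wf : Tape M₁ → Bool) :
    Walk s.2.2 Y n (act c' (control (wk c') (ix c') s mv wf (fun T => ix c' (mark T))
      (fun e => ix c' (flag e)))) where
  toBase := control_base hc.toBase _ _ _ _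
  mode := rfl
  work := (control_work _ _ _ _ _ _).trans hc.work
  index_flag e := (setBit_self _ _).trans (hc.index_flag e)

/-- Moving the index heads past the visited cells. -/
theorem walk_right {Y : ℕ → Option (Bool ⊕ M₁.Aux)} {n : Tape M₁ → ℕ} (k K : ℕ)
    (hc : Walk 2 Y n c') (hk : ∀ T, n T ≤ c'.indexHead (fst T) + k)
    (hK : ∀ T, c'.indexHead (fst T) + k ≤ K) (hs : ∀ T, c'.index (fst T) ⊆ Finset.range (n T)) :
    ∃ s, s ≤ k + 1 ∧ Walk 3 Y n (((compose M₁ M₂).stepT X)^[s] c') ∧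
      ∀ T, (((compose M₁ M₂).stepT X)^[s] c').indexHead (fst T) ≤ K ∧
        (((compose M₁ M₂).stepT X)^[s] c').index (fst T) ⊆
          Finset.range ((((compose M₁ M₂).stepT X)^[s] c').indexHead (fst T) + 1) := by
  have hvisited : ∀ c' : (compose M₁ M₂).Cfg, Walk 2 Y n c' → ∀ T,
      ix c' (visited T) = false ↔ n T ≤ c'.indexHead (fst T) := by
    intro c' hc T
    simp only [ix, hc.index_visited, hc.indexHead_visited, Finset.mem_range,
      decide_eq_false_iff_not, not_lt]
  induction k generalizing c' with
  | zero =>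
    have hA : (compose M₁ M₂).actionT X c' = some (control (wk c') (ix c')
        (c'.state.1, c'.state.2.1, 3) .stay (fun T => ix c' (fst T)) (fun T => ix c' (mark T))
        (fun e => ix c' (flag e))) := by
      change delta M₁ M₂ c'.state _ (wk c') (ix c') = _
      rw [delta, if_neg (by rw [hc.mode]; decide), if_pos hc.mode,
        if_pos fun T => (hvisited _ hc T).2 (hk T)]
    refine ⟨1, le_rfl, ?_⟩
    rw [Function.iterate_one, stepT_of_some hA]
    refine ⟨control_walk hc (c'.state.1, c'.state.2.1, 3) _ _, fun T => ?_⟩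
    rw [control_index, control_indexHead, apply_stay, setBit_self]
    refine ⟨hK T, (hs T).trans (Finset.range_subset_range.2 ?_)⟩
    have := hk T
    omega
  | succ k ih =>
    -- All index heads move in lockstep until the last one has passed its visited segment; `k`
    -- bounds the number of moves still needed.
    by_cases hall : ∀ T, n T ≤ c'.indexHead (fst T)
    · obtain ⟨s, h₁, h₂⟩ := ih hc (fun T => (hall T).trans (Nat.le_add_right _ _))
        (fun T => by have := hK T; omega) hs
      exact ⟨s, by omega, h₂⟩
    · have hA : (compose M₁ M₂).actionT X c' = some (control (wk c') (ix c')
          (c'.state.1, c'.state.2.1, 2) .right (fun T => ix c' (fst T)) (fun T => ix c' (mark T))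
          (fun e => ix c' (flag e))) := by
        change delta M₁ M₂ c'.state _ (wk c') (ix c') = _
        rw [delta, if_neg (by rw [hc.mode]; decide), if_pos hc.mode,
          if_neg fun h => hall fun T => (hvisited _ hc T).1 (h T)]
      have hw := control_walk hc (c'.state.1, c'.state.2.1, 2) .right (fun T => ix c' (fst T))
      rw [← stepT_of_some hA] at hw
      obtain ⟨s, h₁, h₂⟩ := ih hw
        (fun T => by
          rw [stepT_of_some hA, control_indexHead, apply_right]
          have := hk T
          omega)
        (fun T => by
          rw [stepT_of_some hA, control_indexHead, apply_right]
          have := hK T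
          omega)
        (fun T => by
          rw [stepT_of_some hA, control_index, setBit_self]
          exact hs T)
      exact ⟨s + 1, by omega, h₂⟩

/-- The configuration in which the second machine can be started. -/
structure Ready (Y : ℕ → Option (Bool ⊕ M₁.Aux)) (n : Tape M₁ → ℕ) (c' : (compose M₁ M₂).Cfg) :
    Prop extends Base n c' where
  state : c'.state = (M₁.access, M₂.access, 0)
  work : c'.work (.inl M₁.out) = fun j => emb₁ (Y j)
  index_flag_false : c'.index (flag false) = {0}
  index_flag_true : c'.index (flag true) = ∅
  index : ∀ T, c'.index (fst T) = ∅
  head : ∀ T, c'.head (fst T) = 0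
  indexHead : ∀ T, c'.indexHead (fst T) = 0

/-- Moving the index heads back, erasing the index tapes. -/
theorem walk_left {Y : ℕ → Option (Bool ⊕ M₁.Aux)} {n : Tape M₁ → ℕ} (k : ℕ)
    (hc : Walk 3 Y n c') (hk : ∀ T, c'.indexHead (fst T) ≤ k)
    (hs : ∀ T, c'.index (fst T) ⊆ Finset.range (c'.indexHead (fst T) + 1)) :
    ∃ s, s ≤ k + 1 ∧ Ready Y n (((compose M₁ M₂).stepT X)^[s] c') := by
  have hmark : ∀ c' : (compose M₁ M₂).Cfg, Walk 3 Y n c' → ∀ T,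
      ix c' (mark T) = true ↔ c'.indexHead (fst T) = 0 := by
    intro c' hc T
    simp only [ix, hc.index_mark, hc.indexHead_mark, Finset.mem_singleton, decide_eq_true_eq]
  induction k generalizing c' with
  | zero =>
    have hk0 : ∀ T, c'.indexHead (fst T) = 0 := fun T => Nat.le_zero.1 (hk T)
    have hA : (compose M₁ M₂).actionT X c' = some (control (wk c') (ix c')
        (M₁.access, M₂.access, 0) .stay (fun _ => false) (fun T => ix c' (mark T))
        (fun e => !e)) := by
      change delta M₁ M₂ c'.state _ (wk c') (ix c') = _
      rw [delta, if_neg (by rw [hc.mode]; decide), if_neg (by rw [hc.mode]; decide),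
        if_pos hc.mode, if_pos fun T => (hmark _ hc T).2 (hk0 T)]
    refine ⟨1, le_rfl, ?_⟩
    rw [Function.iterate_one, stepT_of_some hA]
    have hi : ∀ T, (act c' (control (wk c') (ix c') (M₁.access, M₂.access, 0) .stay
        (fun _ => false) (fun T => ix c' (mark T)) (fun e => !e))).index (fst T) = ∅ := by
      intro T
      rw [control_index, setBit, if_neg (by simp), hk0]
      have := hs T
      rw [hk0] at this
      refine Finset.eq_empty_of_forall_notMem fun j hj => ?_
      have hj' := Finset.mem_range.1 (this (Finset.mem_of_mem_erase hj))
      exact Finset.ne_of_mem_erase hj (by omega)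
    exact {
      toBase := control_base hc.toBase _ _ _ _
      state := rfl
      work := (control_work _ _ _ _ _ _).trans hc.work
      index_flag_false := by
        rw [act_index, hc.index_flag, hc.indexHead_flag]
        rfl
      index_flag_true := by
        rw [act_index, hc.index_flag, hc.indexHead_flag]
        rfl
      index := hi
      -- This action enters the access state with empty index tapes, so a single jump rewinds all
      -- these heads.
      head := fun T => by
        rw [act_head_of_eq rfl]
        exact (congrArg address (hi T)).trans address_empty
      indexHead := fun T => (control_indexHead _ _ _ _ _ _).trans (hk0 T) }
  | succ k ih =>
    -- Heads that have arrived in cell `0` ignore further left moves while the others catch up.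
    -- Every cell is erased as it is left, so no `1` remains to the right of a head.
    by_cases hall : ∀ T, c'.indexHead (fst T) = 0
    · obtain ⟨s, h₁, h₂⟩ := ih hc (fun T => by rw [hall T]; omega) hs
      exact ⟨s, by omega, h₂⟩
    · have hA : (compose M₁ M₂).actionT X c' = some (control (wk c') (ix c')
          (c'.state.1, c'.state.2.1, 3) .left (fun _ => false) (fun T => ix c' (mark T))
          (fun e => ix c' (flag e))) := by
        change delta M₁ M₂ c'.state _ (wk c') (ix c') = _
        rw [delta, if_neg (by rw [hc.mode]; decide), if_neg (by rw [hc.mode]; decide),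
          if_pos hc.mode, if_neg fun h => hall fun T => (hmark _ hc T).1 (h T)]
      have hw := control_walk hc (c'.state.1, c'.state.2.1, 3) .left (fun _ => false)
      rw [← stepT_of_some hA] at hw
      obtain ⟨s, h₁, h₂⟩ := ih hw
        (fun T => by
          rw [stepT_of_some hA, control_indexHead, apply_left]
          have := hk T
          omega)
        (fun T => by
          rw [stepT_of_some hA, control_indexHead, control_index, apply_left, setBit,
            if_neg (by simp)]
          intro j hj
          have h₁ := Finset.ne_of_mem_erase hj
          have h₂ := Finset.mem_range.1 (hs T (Finset.mem_of_mem_erase hj))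
          rw [Finset.mem_range]
          omega)
      exact ⟨s + 1, by omega, h₂⟩

/-- The configuration `c'` represents the configuration `c` of the second machine, which is run on
the output `Y` of the first machine. -/
structure Rel₂ (Y : ℕ → Option (Bool ⊕ M₁.Aux)) (c : M₂.Cfg) (c' : (compose M₁ M₂).Cfg) :
    Prop where
  state : c'.state = (M₁.access, c.state, 0)
  work : ∀ w, c'.work (.inr (.inl w)) = fun j => emb₂ (c.work w j)
  work_out : c'.work (.inl M₁.out) = fun j => emb₁ (Y j)
  index : ∀ T, c'.index (snd T) = c.index T
  head : ∀ T, c'.head (snd T) = c.head T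
  indexHead : ∀ T, c'.indexHead (snd T) = c.indexHead T
  index_flag : ∀ e, c'.index (flag e) = {0}
  indexHead_flag : ∀ e, c'.indexHead (flag e) = 0

theorem Ready.launch {Y : ℕ → Option (Bool ⊕ M₁.Aux)} {n : Tape M₁ → ℕ} (hc : Ready Y n c') :
    Rel₂ Y M₂.init ((compose M₁ M₂).stepT X c') := by
  have hA : (compose M₁ M₂).actionT X c' = some (control (wk c') (ix c')
      (M₁.access, M₂.start, 0) .stay (fun T => ix c' (fst T)) (fun T => ix c' (mark T))
      (fun _ => true)) := by
    change delta M₁ M₂ c'.state _ (wk c') (ix c') = _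
    have h₁ : ix c' (flag false) = true := by
      simp only [ix, hc.index_flag_false, hc.indexHead_flag]; rfl
    have h₂ : ix c' (flag true) = false := by
      simp only [ix, hc.index_flag_true]; rfl
    rw [hc.state]
    simp only [delta, h₁, h₂, if_true]
    rfl
  rw [stepT_of_some hA]
  set A := control (wk c') (ix c') (M₁.access, M₂.start, 0) .stay (fun T => ix c' (fst T))
      (fun T => ix c' (mark T)) (fun _ => true) with hA'
  have hhead : ∀ T, c'.head T = 0 → (act c' A).index T = ∅ → (act c' A).head T = 0 := by
    intro T h₀ hT
    by_cases hs : A.next = (compose M₁ M₂).access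
    · rw [act_head_of_eq hs]
      exact (congrArg address hT).trans address_empty
    · rw [act_head_of_ne hs]
      exact h₀
  have hb : Base n (act c' A) := control_base hc.toBase _ _ _ _
  have hfst : ∀ T, (act c' A).index (fst T) = ∅ := by
    intro T
    rw [hA', control_index, setBit_self]
    exact hc.index T
  have hsnd : ∀ T, (act c' A).index (snd T) = ∅ := by
    rintro (i | w)
    · fin_cases i
      · exact hfst (.inl 0)
      · exact hfst (.inr M₁.out)
    · exact hb.index₂ w
  refine ⟨rfl, hb.work₂, (control_work _ _ _ _ _ _).trans hc.work, hsnd, fun T => ?_, fun T => ?_,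
    fun e => ?_, hb.indexHead_flag⟩
  · refine hhead _ ?_ (hsnd T)
    rcases T with i | w
    · fin_cases i
      · exact hc.head (.inl 0)
      · exact hc.head (.inr M₁.out)
    · exact hc.head₂ w
  · rcases T with i | w
    · fin_cases i
      · exact hc.indexHead (.inl 0)
      · exact hc.indexHead (.inr M₁.out)
    · exact hb.indexHead₂ w
  · rw [act_index, hc.indexHead_flag]
    cases e
    · rw [hc.index_flag_false]; rfl
    · rw [hc.index_flag_true]; rfl

/-- The roles are exchanged: the first state component is kept equal to `M₁.access`, so jumps are
those of the second machine. Its input tape `1` is a work tape here, but it is only ever rewritten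
with the symbol read, so `Y` persists. -/
theorem perform₂_rel {Y : ℕ → Option (Bool ⊕ M₁.Aux)} {c : M₂.Cfg} (hc : Rel₂ Y c c')
    (A : RATMAction M₂.State (Fin 2) M₂.Work (Option (Bool ⊕ M₂.Aux))) :
    Rel₂ Y (act c A) (act c' (perform₂ (wk c') (ix c') A)) := by
  have hnext : (perform₂ (wk c') (ix c') A).next = (compose M₁ M₂).access ↔
      A.next = M₂.access := by
    simp [perform₂]
  have hindex : ∀ T, (act c' (perform₂ (wk c') (ix c') A)).index (snd T) = (act c A).index T := by
    intro T
    rw [act_index, act_index, hc.index, hc.indexHead]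
    simp only [perform₂, sndInv_snd, Option.elim_some]
  refine ⟨rfl, fun w => ?_, (Function.update_eq_self _ _).trans hc.work_out, hindex, fun T => ?_,
    fun T => ?_, fun e => (setBit_self _ _).trans (hc.index_flag e), hc.indexHead_flag⟩
  · rw [act_work, act_work, hc.work]
    have := hc.head (.inr w)
    rw [this]
    exact (Function.comp_update emb₂ (c.work w) _ _).symm
  · by_cases hs : A.next = M₂.access
    · rw [act_head_of_eq hs, act_head_of_eq (hnext.2 hs)]
      exact congrArg address (hindex T)
    · rw [act_head_of_ne hs, act_head_of_ne (mt hnext.1 hs), hc.head]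
      simp only [perform₂, sndInv_snd, Option.elim_some]
  · rw [act_indexHead, act_indexHead, hc.indexHead]
    simp only [perform₂, sndInv_snd, Option.elim_some]

/-- The input tapes of the second machine. -/
def tapes₂ (X : Fin 2 → ℕ → Option Bool) (Y : ℕ → Option (Bool ⊕ M₁.Aux)) :
    Fin 2 → ℕ → Option Bool := fun i => if i = 0 then X 0 else fun j => bitOf (Y j)

theorem actionT_sim₂ {Y : ℕ → Option (Bool ⊕ M₁.Aux)} {c : M₂.Cfg} (hc : Rel₂ Y c c') :
    (compose M₁ M₂).actionT X c' =
      (M₂.actionT (tapes₂ X Y) c).map (perform₂ (wk c') (ix c')) := by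
  have hflag : ∀ e, ix c' (flag e) = true := fun e => by
    simp only [ix, hc.index_flag, hc.indexHead_flag]; rfl
  have h1 : (fun i : Fin 2 => if i = 0 then X 0 (c'.head (.inl 0)) else
      bitOf (wk c' (.inl M₁.out))) = fun i => tapes₂ X Y i (c.head (.inl i)) := by
    funext i
    fin_cases i
    · exact congrArg (X 0) (hc.head (.inl 0))
    · have := hc.head (.inl 1)
      change bitOf (wk c' (.inl M₁.out)) = bitOf (Y (c.head (.inl 1)))
      rw [← this, wk, hc.work_out, bitOf_emb₁]
  have h2 : (fun w => proj₂ (wk c' (.inr (.inl w)))) = fun w => c.work w (c.head (.inr w)) :=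
    funext fun w => by
      have := hc.head (.inr w)
      simp only [wk, hc.work, this, proj₂_emb₂]
  have h3 : (fun T => ix c' (snd T)) = fun T => decide (c.indexHead T ∈ c.index T) :=
    funext fun T => by simp only [ix, hc.index, hc.indexHead]
  change delta M₁ M₂ c'.state (fun i => X i (c'.head (.inl i))) (wk c') (ix c') = _
  rw [hc.state]
  simp only [delta, hflag, h1, h2, h3]
  rfl

theorem Rel₂.step {Y : ℕ → Option (Bool ⊕ M₁.Aux)} {c : M₂.Cfg} (hc : Rel₂ Y c c')
    {A : RATMAction M₂.State (Fin 2) M₂.Work (Option (Bool ⊕ M₂.Aux))}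
    (hA : M₂.actionT (tapes₂ X Y) c = some A) :
    Rel₂ Y (act c A) ((compose M₁ M₂).stepT X c') := by
  have h := actionT_sim₂ (X := X) hc
  rw [hA, Option.map_some] at h
  rw [stepT_of_some h]
  exact perform₂_rel hc A

theorem haltsWith {t₁ t₂ : ℕ} {Y₁ : ℕ → Option (Bool ⊕ M₁.Aux)} {Y₂ : ℕ → Option (Bool ⊕ M₂.Aux)}
    (h₁ : M₁.HaltsWith X t₁ Y₁) (h₂ : M₂.HaltsWith (tapes₂ X Y₁) t₂ Y₂) :
    (compose M₁ M₂).HaltsWith X (4 * t₁ + t₂ + 5) fun j => emb₂ (Y₂ j) := by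
  obtain ⟨i, hi, s₁, hs₁, R₁⟩ := simulate (R := Rel₁ (M₂ := M₂)) (X := X) (X' := X)
    (T := t₁) (K := 1) (fun i _ c c' A hc hA => ⟨1, le_rfl, hc.step hA⟩) t₁ 0 (by omega) rel₁_init
  rw [zero_add, ← Function.iterate_succ_apply] at R₁
  generalize hc₁ : ((compose M₁ M₂).stepT X)^[s₁.succ] (compose M₁ M₂).init = c₁ at R₁
  have hA := actionT_sim₁ (X := X) R₁
  rw [h₁.1, Option.elim_none] at hA
  obtain ⟨n, hb, hn⟩ := R₁.base
  have hw : Walk 2 Y₁ n ((compose M₁ M₂).stepT X c₁) := by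
    rw [stepT_of_some hA]
    exact {
      toBase := control_base hb _ _ _ _
      mode := rfl
      work := by rw [control_work, R₁.work, h₁.2]
      index_flag := fun e => (setBit_self _ _).trans (R₁.index_flag e) }
  -- At most `t₁` cells of each index tape have been visited, and the index heads are at positions
  -- up to `t₁`; so `t₁` moves suffice and lead to positions up to `2 * t₁`.
  obtain ⟨s₂, hs₂, W, hW⟩ := walk_right (X := X) t₁ (2 * t₁) hw
    (fun T => by have := hn T; omega)
    (fun T => by
      rw [stepT_of_some hA, control_indexHead, apply_stay]
      have := hn T
      omega)
    (fun T => by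
      rw [stepT_of_some hA, control_index, setBit_self]
      exact (hn T).2.2)
  obtain ⟨s₃, hs₃, R₃⟩ := walk_left (X := X) (2 * t₁) W (fun T => (hW T).1) (fun T => (hW T).2)
  obtain ⟨-, -, s₄, hs₄, R₄⟩ := simulate (R := fun _ => Rel₂ Y₁) (X := tapes₂ X Y₁) (X' := X)
    (T := t₂) (K := 1) (fun i _ c c' A hc hA => ⟨1, le_rfl, hc.step hA⟩) t₂ 0 (by omega)
    (R₃.launch (X := X))
  have hend := actionT_sim₂ (X := X) R₄
  rw [h₂.1, Option.map_none] at hend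
  have hout := R₄.work M₂.out
  rw [h₂.2] at hout
  set f := (compose M₁ M₂).stepT X
  have hiter : f^[s₄ + (1 + (s₃ + (s₂ + (1 + s₁.succ))))] (compose M₁ M₂).init =
      f^[s₄] (f (f^[s₃] (f^[s₂] (f c₁)))) := by
    simp only [Function.iterate_add_apply, Function.iterate_one, hc₁]
  -- The bound is the sum of `1 + t₁` for initialising and running the first machine, `1` for
  -- noticing that it halts, `t₁ + 1` and `2 * t₁ + 1` for the two walks, `1` for the launch, and
  -- `t₂`.
  refine HaltsWith.mono (t := s₄ + (1 + (s₃ + (s₂ + (1 + s₁.succ)))))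
    ⟨by rw [hiter]; exact hend, by rw [hiter]; exact hout⟩ ?_
  omega

end compose

end RATM

/-! ### Machines with a clock -/

/-- The number with digits `d` in base `L + 1`, the least significant digit first. -/
def digitsValue (L : ℕ) {m : ℕ} (d : Fin m → ℕ) : ℕ := ∑ r, d r * (L + 1) ^ (r : ℕ)

theorem digitsValue_succ (L : ℕ) {m : ℕ} (d : Fin (m + 1) → ℕ) :
    digitsValue L d = d 0 + (L + 1) * digitsValue L fun r => d r.succ := by
  simp only [digitsValue, Fin.sum_univ_succ, Fin.val_zero, pow_zero, mul_one, Fin.val_succ,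
    Finset.mul_sum, pow_succ]
  congr 1
  exact Finset.sum_congr rfl fun r _ => by ring

open Classical in
/-- The digits of the next number. -/
noncomputable def digitsNext (L : ℕ) {m : ℕ} (d : Fin m → ℕ) (r : Fin m) : ℕ :=
  if ∀ s, s < r → d s = L then (if d r = L then 0 else d r + 1) else d r

/-- If the lowest digit is `L`, it becomes `0` and the remaining digits advance as a number of their
own: `L + (L + 1) * v + 1 = (L + 1) * (v + 1)`. Otherwise only the lowest digit changes. -/
theorem digitsValue_next (L : ℕ) {m : ℕ} (d : Fin m → ℕ) (h : ¬ ∀ r, d r = L) :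
    digitsValue L (digitsNext L d) = digitsValue L d + 1 := by
  induction m with
  | zero => exact absurd (fun r => r.elim0) h
  | succ m ih =>
    rw [digitsValue_succ, digitsValue_succ]
    have h0 : digitsNext L d 0 = if d 0 = L then 0 else d 0 + 1 :=
      if_pos fun s hs => absurd hs (Fin.not_lt_zero s)
    rw [h0]
    by_cases hd : d 0 = L
    · have h1 : (fun r : Fin m => digitsNext L d r.succ) =
          digitsNext L fun r => d r.succ := by
        funext r
        have : (∀ s, s < r.succ → d s = L) ↔ ∀ s, s < r → d s.succ = L := by
          rw [Fin.forall_fin_succ]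
          simp [hd]
        simp only [digitsNext, this]
      rw [h1, ih _ fun h' => h (Fin.forall_fin_succ.2 ⟨hd, h'⟩), if_pos hd, hd]
      ring
    · have h1 : (fun r : Fin m => digitsNext L d r.succ) = fun r => d r.succ := by
        funext r
        exact if_neg fun h' => hd (h' 0 (Fin.succ_pos r))
      rw [h1, if_neg hd]
      ring

theorem digitsValue_lt (L : ℕ) {m : ℕ} (d : Fin m → ℕ) (h : ∀ r, d r ≤ L) :
    digitsValue L d < (L + 1) ^ m := by
  induction m with
  | zero => simp [digitsValue]
  | succ m ih =>
    rw [digitsValue_succ, pow_succ]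
    have h₁ := ih (fun r => d r.succ) fun r => h _
    have h₂ := h 0
    nlinarith

theorem digitsValue_max (L : ℕ) {m : ℕ} (d : Fin m → ℕ) (h : ∀ r, d r = L) :
    digitsValue L d + 1 = (L + 1) ^ m := by
  induction m with
  | zero => simp [digitsValue]
  | succ m ih =>
    rw [digitsValue_succ, pow_succ, ← ih (fun r => d r.succ) fun r => h _, h 0]
    ring

namespace RATM

namespace clock

variable {M : RATM 2} {k : ℕ}

/-- The work tapes: those of the machine, three for each digit of the clock, and two more.  Of the
tapes other than those of the machine, only the index tapes are used. -/
abbrev Work (M : RATM 2) (k : ℕ) : Type :=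
  M.Work ⊕ Fin (k + 1) ⊕ Fin (k + 1) ⊕ Fin (k + 1) ⊕ Bool

/-- The states of the machine with a clock. -/
abbrev State (M : RATM 2) : Type := M.State × Fin 5

/-- The actions of the machine with a clock. -/
abbrev Action (M : RATM 2) (k : ℕ) : Type :=
  RATMAction (State M) (Fin 2) (Work M k) (Option (Bool ⊕ M.Aux))

/-- The tapes of the original machine. -/
abbrev orig : Fin 2 ⊕ M.Work → Fin 2 ⊕ Work M k
  | .inl i => .inl i
  | .inr w => .inr (.inl w)

/-- The tape whose index tape marks position `0` of digit `r`.  The position of a digit is the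
position of the index head of this tape. -/
abbrev low (r : Fin (k + 1)) : Fin 2 ⊕ Work M k := .inr (.inr (.inl r))

/-- The tape whose index tape marks the last position of digit `r`. -/
abbrev high (r : Fin (k + 1)) : Fin 2 ⊕ Work M k := .inr (.inr (.inr (.inl r)))

/-- The tape whose index tape tells in cell `0` whether the position of digit `r` decreases. -/
abbrev dir (r : Fin (k + 1)) : Fin 2 ⊕ Work M k := .inr (.inr (.inr (.inr (.inl r))))

/-- The tapes whose index tapes tell in cell `0` whether the length of the input has been measured
(`false`) and whether the original machine has been started (`true`). -/
abbrev flag (e : Bool) : Fin 2 ⊕ Work M k := .inr (.inr (.inr (.inr (.inr e))))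

/-- Digit `r` cannot be increased. -/
def atEnd (ix : Fin 2 ⊕ Work M k → Bool) (r : Fin (k + 1)) : Bool :=
  if ix (dir r) then ix (low r) else ix (high r)

open Classical in
/-- The digits before `r` cannot be increased. -/
noncomputable def carry (ix : Fin 2 ⊕ Work M k → Bool) (r : Fin (k + 1)) : Bool :=
  decide (∀ s, s < r → atEnd ix s = true)

/-- The move of the index heads of digit `r` in a step of the clock. -/
noncomputable def digitMove (ix : Fin 2 ⊕ Work M k → Bool) (r : Fin (k + 1)) : HeadMove :=
  if carry ix r && !atEnd ix r then (if ix (dir r) then .left else .right) else .stay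

/-- The action that enters state `s`, moves the index heads of the input tapes and of the digits by
`m`, and writes `wi`, `wl`, `wh` and `e` on the index tapes of the input tapes, on the marking
tapes and on the flags. -/
def control (wk : Work M k → Option (Bool ⊕ M.Aux)) (ix : Fin 2 ⊕ Work M k → Bool) (s : State M)
    (m : HeadMove) (wi : Fin 2 → Bool) (wl wh : Fin (k + 1) → Bool) (e : Bool → Bool) :
    Action M k where
  next := s
  write := wk
  writeIndex := fun
    | .inl i => wi i
    | .inr (.inr (.inl r)) => wl r
    | .inr (.inr (.inr (.inl r))) => wh r
    | .inr (.inr (.inr (.inr (.inr b)))) => e b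
    | T => ix T
  move := fun _ => .stay
  moveIndex := fun
    | .inl _ => m
    | .inr (.inr (.inl _)) => m
    | .inr (.inr (.inr (.inl _))) => m
    | _ => .stay

/-- The action that corresponds to the action `A` of the original machine. -/
noncomputable def perform (wk : Work M k → Option (Bool ⊕ M.Aux)) (ix : Fin 2 ⊕ Work M k → Bool)
    (A : RATMAction M.State (Fin 2) M.Work (Option (Bool ⊕ M.Aux))) : Action M k where
  next := (A.next, 0)
  write := fun
    | .inl w => A.write w
    | .inr w => wk (.inr w)
  writeIndex := fun
    | .inl i => A.writeIndex (.inl i)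
    | .inr (.inl w) => A.writeIndex (.inr w)
    | .inr (.inr (.inr (.inr (.inl r)))) => xor (ix (dir r)) (carry ix r && atEnd ix r)
    | T => ix T
  move := fun
    | .inl i => A.move (.inl i)
    | .inr (.inl w) => A.move (.inr w)
    | _ => .stay
  moveIndex := fun
    | .inl i => A.moveIndex (.inl i)
    | .inr (.inl w) => A.moveIndex (.inr w)
    | .inr (.inr (.inl r)) => digitMove ix r
    | .inr (.inr (.inr (.inl r))) => digitMove ix r
    | _ => .stay

open Classical in
/-- The transition function of the machine with a clock. -/
noncomputable def delta (M : RATM 2) (k : ℕ) (s : State M) (inp : Fin 2 → Option Bool)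
    (wk : Work M k → Option (Bool ⊕ M.Aux)) (ix : Fin 2 ⊕ Work M k → Bool) :
    Option (Action M k) :=
  let wi (i : Fin 2) := ix (.inl i)
  let wl (r : Fin (k + 1)) := ix (low r)
  let wh (r : Fin (k + 1)) := ix (high r)
  let e (b : Bool) := ix (flag b)
  if s.2 = 1 then some (control wk ix (M.access, 0) .stay (fun _ => true) (fun _ => true) wh e)
  else if s.2 = 2 then some (control wk ix (M.access, 0) .stay (fun _ => true) wl wh e)
  else if s.2 = 3 then
    if ix (low 0) = true then some (control wk ix (M.access, 0) .stay wi wl wh (fun b => !b))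
    else some (control wk ix (s.1, 3) .left wi wl wh e)
  else if s.2 = 4 then some (control wk ix (s.1, 3) .stay wi wl (fun _ => true) e)
  else if ix (flag false) = false then
    some (control wk ix (s.1, if ∀ i, inp i = none then 4 else 2) .right (fun _ => false) wl wh e)
  else if ix (flag true) = false then
    some (control wk ix (M.start, 0) .stay wi wl wh (fun _ => true))
  else if ∀ r, atEnd ix r = true then none
  else (M.δ s.1 inp (fun w => wk (.inl w)) (fun T => ix (orig T))).map (perform wk ix)

end clock

/-- The machine that runs `M`, but for less than `(L + 1) ^ (k + 1)` steps, where `L` is about the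
logarithm of the length of the input.  In modes `1` and `2` of its states, it writes an address that
is a power of two, in mode `4` it marks `L`, in mode `3` it moves the index heads back, and in mode
`0` it checks whether the address is beyond the input, or simulates `M`.  The clock has `k + 1`
digits; after it has reached one of its ends, a digit moves in the other direction. -/
noncomputable abbrev clock (M : RATM 2) (k : ℕ) : RATM 2 where
  State := clock.State M
  finite_state := by
    have := M.finite_state
    infer_instance
  Work := clock.Work M k
  finite_work := by
    have := M.finite_work
    infer_instance
  Aux := M.Aux
  finite_aux := M.finite_aux
  out := .inl M.out
  start := (M.start, 1)
  access := (M.access, 0)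
  δ := clock.delta M k

/-! ### Correctness of the machine with a clock -/

namespace clock

variable {M : RATM 2} {k : ℕ} {X : Fin 2 → ℕ → Option Bool} {c' : (clock M k).Cfg}

/-- The symbols under the heads of the work tapes. -/
abbrev wk (c' : (clock M k).Cfg) : Work M k → Option (Bool ⊕ M.Aux) :=
  fun w => c'.work w (c'.head (.inr w))

/-- The bits under the heads of the index tapes. -/
abbrev ix (c' : (clock M k).Cfg) : Fin 2 ⊕ Work M k → Bool :=
  fun T => decide (c'.indexHead T ∈ c'.index T)

/-- The original machine has not been started, the index heads that move are at `p`, and the last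
position of the digits is marked by `H`. -/
structure Base (p : ℕ) (H : Finset ℕ) (c' : (clock M k).Cfg) : Prop where
  work : ∀ w, c'.work (.inl w) = fun _ => none
  index_work : ∀ w, c'.index (.inr (.inl w)) = ∅
  head_work : ∀ w, c'.head (.inr (.inl w)) = 0
  indexHead_work : ∀ w, c'.indexHead (.inr (.inl w)) = 0
  indexHead_input : ∀ i, c'.indexHead (.inl i) = p
  index_low : ∀ r, c'.index (low r) = {0}
  indexHead_low : ∀ r, c'.indexHead (low r) = p
  index_high : ∀ r, c'.index (high r) = H
  indexHead_high : ∀ r, c'.indexHead (high r) = p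
  index_dir : ∀ r, c'.index (dir r) = ∅
  indexHead_dir : ∀ r, c'.indexHead (dir r) = 0
  indexHead_flag : ∀ e, c'.indexHead (flag e) = 0

/-- The machine is in mode `m`, with `I` on the index tapes of the input tapes. -/
structure Prep (m : Fin 5) (p : ℕ) (H I : Finset ℕ) (c' : (clock M k).Cfg) : Prop
    extends Base p H c' where
  mode : c'.state.2 = m
  index_input : ∀ i, c'.index (.inl i) = I
  index_flag : ∀ e, c'.index (flag e) = ∅

/-- Taking `wh` as a function of the bit read covers both leaving the upper marks alone (`fun e =>
e`) and setting them (`fun _ => true`). -/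
theorem control_base {p : ℕ} {H : Finset ℕ} (hc : Base p H c') (s : State M) (m : HeadMove)
    (wi : Fin 2 → Bool) (wh e : Bool → Bool) (b : Bool) (hb : ∀ r, wh (ix c' (high r)) = b) :
    Base (m.apply p) (setBit H p b) (act c' (control (wk c') (ix c') s m wi
      (fun r => ix c' (low r)) (fun r => wh (ix c' (high r))) e)) where
  work w := (Function.update_eq_self _ _).trans (hc.work w)
  index_work w := (setBit_self _ _).trans (hc.index_work w)
  head_work w := by
    by_cases hs : s = (clock M k).access
    · rw [act_head_of_eq hs]
      exact (congrArg address ((setBit_self _ _).trans (hc.index_work w))).trans address_empty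
    · rw [act_head_of_ne hs]
      exact hc.head_work w
  indexHead_work := hc.indexHead_work
  indexHead_input i := by rw [act_indexHead, hc.indexHead_input]; rfl
  index_low r := (setBit_self _ _).trans (hc.index_low r)
  indexHead_low r := by rw [act_indexHead, hc.indexHead_low]; rfl
  index_high r := by
    rw [act_index, hc.index_high, hc.indexHead_high, ← hb r]; rfl
  indexHead_high r := by rw [act_indexHead, hc.indexHead_high]; rfl
  index_dir r := (setBit_self _ _).trans (hc.index_dir r)
  indexHead_dir := hc.indexHead_dir
  indexHead_flag := hc.indexHead_flag

theorem Base.ix_high {p : ℕ} {H : Finset ℕ} (hc : Base p H c') (r : Fin (k + 1)) :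
    ix c' (high r) = decide (p ∈ H) := by
  simp only [ix, hc.index_high, hc.indexHead_high]

theorem control_prep {m : Fin 5} {p : ℕ} {H I : Finset ℕ} (hc : Prep m p H I c') (s : State M)
    (mv : HeadMove) (b : Bool) :
    Prep s.2 (mv.apply p) H (setBit I p b) (act c' (control (wk c') (ix c') s mv (fun _ => b)
      (fun r => ix c' (low r)) (fun r => ix c' (high r)) (fun e => ix c' (flag e)))) where
  toBase := by
    have := control_base hc.toBase s mv (fun _ => b) (fun e => e) (fun e => ix c' (flag e)) _
      hc.ix_high
    rwa [setBit_self] at this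
  mode := rfl
  index_input i := by
    rw [act_index, hc.index_input, hc.indexHead_input]; rfl
  index_flag e := (setBit_self _ _).trans (hc.index_flag e)

/-- The address `2 ^ j` is checked. -/
structure Check (j : ℕ) (c' : (clock M k).Cfg) : Prop extends Prep 0 j ∅ {j} c' where
  head_input : ∀ i, c'.head (.inl i) = 2 ^ j

theorem address_singleton (j : ℕ) : address {j} = 2 ^ j := Finset.sum_singleton _ _

/-- The first action writes a `1` into cell `0` of the index tapes of the inputs and enters the
access state, so the input heads jump to cell `2 ^ 0`. -/
theorem check_init : Check 0 ((clock M k).stepT X (clock M k).init) := by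
  set c' := (clock M k).init
  have hA : (clock M k).actionT X c' = some (control (wk c') (ix c') (M.access, 0) .stay
      (fun _ => true) (fun _ => true) (fun r => ix c' (high r)) (fun e => ix c' (flag e))) := rfl
  rw [stepT_of_some hA]
  refine ⟨⟨⟨?_, ?_, ?_, ?_, ?_, ?_, ?_, ?_, ?_, ?_, ?_, ?_⟩, rfl, fun i => rfl,
    fun e => setBit_self ∅ 0⟩, fun i => ?_⟩
  · exact fun w => Function.update_eq_self _ _
  · exact fun w => setBit_self ∅ 0
  · intro w
    rw [act_head_of_eq rfl]
    exact (congrArg address (setBit_self ∅ 0)).trans address_empty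
  · exact fun w => rfl
  · exact fun i => rfl
  · exact fun r => rfl
  · exact fun r => rfl
  · exact fun r => setBit_self ∅ 0
  · exact fun r => rfl
  · exact fun r => setBit_self ∅ 0
  · exact fun r => rfl
  · exact fun r => rfl
  · rw [act_head_of_eq rfl]
    exact address_singleton 0

-- The bit for `2 ^ j` is erased while the index heads move right. Writing a bit there gives the
-- next power of two, so each probe costs two steps.
open Classical in
theorem Check.step {j : ℕ} (hc : Check j c') :
    Prep (if ∀ i, X i (2 ^ j) = none then 4 else 2) (j + 1) ∅ ∅ ((clock M k).stepT X c') := by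
  have hA : (clock M k).actionT X c' = some (control (wk c') (ix c')
      (c'.state.1, if ∀ i, X i (2 ^ j) = none then 4 else 2) .right (fun _ => false)
      (fun r => ix c' (low r)) (fun r => ix c' (high r)) (fun e => ix c' (flag e))) := by
    have hflag : ix c' (flag false) = false := by
      simp only [ix, hc.index_flag]; rfl
    have hinp : (fun i : Fin 2 => X i (c'.head (.inl i))) = fun i => X i (2 ^ j) :=
      funext fun i => by rw [hc.head_input]
    change delta M k c'.state (fun i => X i (c'.head (.inl i))) (wk c') (ix c') = _
    rw [hinp]
    have hm := hc.mode
    simp only [delta, hm, hflag, if_true]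
    rfl
  rw [stepT_of_some hA]
  have := control_prep hc.toPrep (c'.state.1, if ∀ i, X i (2 ^ j) = none then 4 else 2) .right false
  have he : setBit {j} j false = ∅ := by simp [setBit]
  rwa [he] at this

theorem Prep.set {j : ℕ} (hc : Prep 2 j ∅ ∅ c') : Check j ((clock M k).stepT X c') := by
  have hA : (clock M k).actionT X c' = some (control (wk c') (ix c')
      (M.access, 0) .stay (fun _ => true)
      (fun r => ix c' (low r)) (fun r => ix c' (high r)) (fun e => ix c' (flag e))) := by
    change delta M k c'.state (fun i => X i (c'.head (.inl i))) (wk c') (ix c') = _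
    simp only [delta, hc.mode]
    rfl
  rw [stepT_of_some hA]
  refine ⟨control_prep hc (M.access, 0) .stay true, fun i => ?_⟩
  rw [act_head_of_eq rfl, hc.index_input, hc.indexHead_input]
  exact address_singleton j

/-- Powers of two are probed until one lies on blanks of both inputs. For genuine strings this
bounds their lengths by `2 ^ L`, so the logarithm is measured without scanning the input. -/
theorem Check.measure {J : ℕ} (hJ : ∀ i, X i (2 ^ J) = none) (d : ℕ) {j : ℕ} (hj : j + d = J)
    (hc : Check j c') :
    ∃ s, s ≤ 2 * d + 1 ∧ ∃ L, L ≤ J ∧ (∀ i, X i (2 ^ L) = none) ∧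
      Prep 4 (L + 1) ∅ ∅ (((clock M k).stepT X)^[s] c') := by
  induction d generalizing j c' with
  | zero =>
    obtain rfl : j = J := by omega
    have := hc.step (X := X)
    rw [if_pos hJ] at this
    exact ⟨1, le_rfl, j, le_rfl, hJ, this⟩
  | succ d ih =>
    have h := hc.step (X := X)
    by_cases hn : ∀ i, X i (2 ^ j) = none
    · rw [if_pos hn] at h
      exact ⟨1, by omega, j, by omega, hn, h⟩
    · rw [if_neg hn] at h
      obtain ⟨s, hs, h'⟩ := ih (by omega) (h.set (X := X))
      exact ⟨s + 2, by omega, h'⟩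

theorem Prep.markHigh {L : ℕ} (hc : Prep 4 L ∅ ∅ c') :
    Prep 3 L {L} ∅ ((clock M k).stepT X c') := by
  have hA : (clock M k).actionT X c' = some (control (wk c') (ix c')
      (c'.state.1, 3) .stay (fun i => ix c' (.inl i))
      (fun r => ix c' (low r)) (fun _ => true) (fun e => ix c' (flag e))) := by
    change delta M k c'.state (fun i => X i (c'.head (.inl i))) (wk c') (ix c') = _
    simp only [delta, hc.mode]
    rfl
  rw [stepT_of_some hA]
  exact {
    toBase := control_base hc.toBase _ .stay _ (fun _ => true) _ true fun _ => rfl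
    mode := rfl
    index_input := fun i => (setBit_self _ _).trans (hc.index_input i)
    index_flag := fun e => (setBit_self _ _).trans (hc.index_flag e) }

/-- The configuration in which the original machine can be started. -/
structure Ready (L : ℕ) (c' : (clock M k).Cfg) : Prop extends Base 0 {L} c' where
  state : c'.state = (M.access, 0)
  index_input : ∀ i, c'.index (.inl i) = ∅
  head_input : ∀ i, c'.head (.inl i) = 0
  index_flag_false : c'.index (flag false) = {0}
  index_flag_true : c'.index (flag true) = ∅

theorem Prep.back {L p : ℕ} (hc : Prep 3 p {L} ∅ c') :
    ∃ s, s ≤ p + 1 ∧ Ready L (((clock M k).stepT X)^[s] c') := by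
  induction p generalizing c' with
  | zero =>
    have hA : (clock M k).actionT X c' = some (control (wk c') (ix c')
        (M.access, 0) .stay (fun i => ix c' (.inl i))
        (fun r => ix c' (low r)) (fun r => ix c' (high r)) (fun e => !e)) := by
      have hlow : ix c' (low 0) = true := by
        simp only [ix, hc.index_low, hc.indexHead_low]; rfl
      change delta M k c'.state (fun i => X i (c'.head (.inl i))) (wk c') (ix c') = _
      simp only [delta, hc.mode, hlow, if_true]
      rfl
    refine ⟨1, le_rfl, ?_⟩
    rw [Function.iterate_one, stepT_of_some hA]
    have hi : ∀ i : Fin 2, setBit (c'.index (.inl i)) (c'.indexHead (.inl i))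
        (ix c' (.inl i)) = ∅ := fun i => (setBit_self _ _).trans (hc.index_input i)
    exact {
      toBase := by
        have := control_base hc.toBase (M.access, 0) .stay (fun i => ix c' (.inl i)) (fun e => e)
          (fun e => !e) _ hc.ix_high
        rwa [setBit_self] at this
      state := rfl
      index_input := hi
      head_input := fun i => by
        rw [act_head_of_eq rfl]
        exact (congrArg address (hi i)).trans address_empty
      index_flag_false := by
        rw [act_index, hc.index_flag, hc.indexHead_flag]; rfl
      index_flag_true := by
        rw [act_index, hc.index_flag, hc.indexHead_flag]; rfl }
  | succ p ih =>
    have hA : (clock M k).actionT X c' = some (control (wk c') (ix c')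
        (c'.state.1, 3) .left (fun i => ix c' (.inl i))
        (fun r => ix c' (low r)) (fun r => ix c' (high r)) (fun e => ix c' (flag e))) := by
      have hlow : ix c' (low 0) = false := by
        simp only [ix, hc.index_low, hc.indexHead_low]
        simp
      change delta M k c'.state (fun i => X i (c'.head (.inl i))) (wk c') (ix c') = _
      simp only [delta, hc.mode, hlow]
      rfl
    have hi : (fun i : Fin 2 => ix c' (.inl i)) = fun _ => false := funext fun i => by
      simp only [ix, hc.index_input]
      rfl
    rw [hi] at hA
    have h := control_prep hc (c'.state.1, 3) .left false
    have he : setBit ∅ (p + 1) false = ∅ := rfl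
    rw [← stepT_of_some hA, he] at h
    obtain ⟨s, hs, h'⟩ := ih h
    exact ⟨s + 1, by omega, h'⟩

/-- The digits of the clock, if their positions are `pos` and their directions are `dn`. -/
def digits (L : ℕ) (pos : Fin (k + 1) → ℕ) (dn : Fin (k + 1) → Bool) (r : Fin (k + 1)) : ℕ :=
  if dn r then L - pos r else pos r

/-- The clock shows `i`, and its digits have positions up to `L`. -/
structure Shows (L i : ℕ) (c' : (clock M k).Cfg) : Prop where
  index_low : ∀ r, c'.index (low r) = {0}
  index_high : ∀ r, c'.index (high r) = {L}
  indexHead_high : ∀ r, c'.indexHead (high r) = c'.indexHead (low r)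
  indexHead_low_le : ∀ r, c'.indexHead (low r) ≤ L
  indexHead_dir : ∀ r, c'.indexHead (dir r) = 0
  index_flag : ∀ e, c'.index (flag e) = {0}
  indexHead_flag : ∀ e, c'.indexHead (flag e) = 0
  value : digitsValue L (digits L (fun r => c'.indexHead (low r)) fun r => ix c' (dir r)) = i

/-- The configuration `c'` represents the configuration `c` of the original machine, after `i`
steps. -/
structure Rel (L i : ℕ) (c : M.Cfg) (c' : (clock M k).Cfg) : Prop extends Shows L i c' where
  state : c'.state = (c.state, 0)
  work : ∀ w, c'.work (.inl w) = c.work w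
  index : ∀ T, c'.index (orig T) = c.index T
  head : ∀ T, c'.head (orig T) = c.head T
  indexHead : ∀ T, c'.indexHead (orig T) = c.indexHead T

theorem Ready.launch {L : ℕ} (hc : Ready L c') : Rel L 0 M.init ((clock M k).stepT X c') := by
  have hA : (clock M k).actionT X c' = some (control (wk c') (ix c')
      (M.start, 0) .stay (fun i => ix c' (.inl i))
      (fun r => ix c' (low r)) (fun r => ix c' (high r)) (fun _ => true)) := by
    have h₁ : ix c' (flag false) = true := by
      simp only [ix, hc.index_flag_false, hc.indexHead_flag]; rfl
    have h₂ : ix c' (flag true) = false := by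
      simp only [ix, hc.index_flag_true]; rfl
    change delta M k c'.state (fun i => X i (c'.head (.inl i))) (wk c') (ix c') = _
    rw [hc.state]
    simp only [delta, h₁, h₂, if_true]
    rfl
  rw [stepT_of_some hA]
  set A := control (wk c') (ix c') (M.start, 0) .stay (fun i => ix c' (.inl i))
    (fun r => ix c' (low r)) (fun r => ix c' (high r)) (fun _ => true)
  have hb : Base 0 {L} (act c' A) := by
    have := control_base hc.toBase (M.start, 0) .stay (fun i => ix c' (.inl i)) (fun e => e)
      (fun _ => true) _ hc.ix_high
    rwa [setBit_self] at this
  have hi : ∀ i, (act c' A).index (.inl i) = ∅ := fun i =>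
    (setBit_self _ _).trans (hc.index_input i)
  refine ⟨⟨hb.index_low, hb.index_high, ?_, ?_, hb.indexHead_dir, ?_, hb.indexHead_flag, ?_⟩, rfl,
    hb.work, ?_, ?_, ?_⟩
  · intro r
    rw [hb.indexHead_high, hb.indexHead_low]
  · intro r
    rw [hb.indexHead_low]
    exact Nat.zero_le _
  · intro e
    rw [act_index, hc.indexHead_flag]
    cases e
    · rw [hc.index_flag_false]; rfl
    · rw [hc.index_flag_true]; rfl
  · refine Finset.sum_eq_zero fun r _ => ?_
    have : ix (act c' A) (dir r) = false := by simp only [ix, hb.index_dir]; rfl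
    simp only [digits, this, hb.indexHead_low]
    simp
  · rintro (i | w)
    · exact hi i
    · exact hb.index_work w
  · rintro (i | w)
    · by_cases hs : A.next = (clock M k).access
      · rw [act_head_of_eq hs]
        exact (congrArg address (hi i)).trans address_empty
      · rw [act_head_of_ne hs]
        exact hc.head_input i
    · exact hb.head_work w
  · rintro (i | w)
    · exact hb.indexHead_input i
    · exact hb.indexHead_work w

theorem Shows.digits_le {L i : ℕ} (hc : Shows L i c') (r : Fin (k + 1)) :
    digits L (fun r => c'.indexHead (low r)) (fun r => ix c' (dir r)) r ≤ L := by
  have := hc.indexHead_low_le r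
  unfold digits
  split_ifs <;> omega

theorem Shows.atEnd_iff {L i : ℕ} (hc : Shows L i c') (r : Fin (k + 1)) :
    atEnd (ix c') r = true ↔
      digits L (fun r => c'.indexHead (low r)) (fun r => ix c' (dir r)) r = L := by
  have h := hc.indexHead_low_le r
  have h₁ : ix c' (low r) = true ↔ c'.indexHead (low r) = 0 := by
    simp only [ix, hc.index_low, Finset.mem_singleton, decide_eq_true_eq]
  have h₂ : ix c' (high r) = true ↔ c'.indexHead (low r) = L := by
    simp only [ix, hc.index_high, hc.indexHead_high, Finset.mem_singleton, decide_eq_true_eq]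
  unfold atEnd digits
  split_ifs
  · rw [h₁]
    dsimp only
    omega
  · rw [h₂]

theorem Shows.carry_iff {L i : ℕ} (hc : Shows L i c') (r : Fin (k + 1)) :
    carry (ix c') r = true ↔ ∀ s, s < r →
      digits L (fun r => c'.indexHead (low r)) (fun r => ix c' (dir r)) s = L := by
  simp only [carry, decide_eq_true_eq, hc.atEnd_iff]

theorem mem_setBit (s : Finset ℕ) (h : ℕ) (b : Bool) : decide (h ∈ setBit s h b) = b := by
  cases b <;> simp [setBit]

/-- Returning a digit from `L` to `0` would take `L` steps. Instead its direction is reversed, which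
turns the same head position from `L` into `0`; thus one tick, carries included, fits into one step.
-/
theorem Shows.perform {L i : ℕ} (hc : Shows L i c')
    (hend : ¬ ∀ r, atEnd (ix c') r = true)
    (A : RATMAction M.State (Fin 2) M.Work (Option (Bool ⊕ M.Aux))) :
    Shows L (i + 1) (act c' (perform (wk c') (ix c') A)) := by
  have hpos : ∀ r, (act c' (clock.perform (wk c') (ix c') A)).indexHead (low r) =
      (digitMove (ix c') r).apply (c'.indexHead (low r)) := fun r => rfl
  have hdir : ∀ r, ix (act c' (clock.perform (wk c') (ix c') A)) (dir r) =
      xor (ix c' (dir r)) (carry (ix c') r && atEnd (ix c') r) := fun r => mem_setBit _ _ _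
  have key : ∀ r, digits L (fun r => (act c' (clock.perform (wk c') (ix c') A)).indexHead (low r))
      (fun r => ix (act c' (clock.perform (wk c') (ix c') A)) (dir r)) r =
      digitsNext L (digits L (fun r => c'.indexHead (low r)) fun r => ix c' (dir r)) r ∧
      (act c' (clock.perform (wk c') (ix c') A)).indexHead (low r) ≤ L := by
    intro r
    have hle := hc.indexHead_low_le r
    have hc₁ := hc.carry_iff r
    have hc₂ := hc.atEnd_iff r
    simp only [digitsNext, ← hc₁, ← hc₂]
    simp only [digits] at hc₂ ⊢
    rw [hdir, hpos]
    simp only [digitMove]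
    cases hca : carry (ix c') r <;> cases hae : atEnd (ix c') r <;> cases hd : ix c' (dir r) <;>
      simp [apply_stay, apply_left, apply_right, hd, hae] at hc₂ ⊢ <;> omega
  refine ⟨fun r => (setBit_self _ _).trans (hc.index_low r),
    fun r => (setBit_self _ _).trans (hc.index_high r), fun r => ?_, fun r => (key r).2,
    hc.indexHead_dir, fun e => (setBit_self _ _).trans (hc.index_flag e), hc.indexHead_flag, ?_⟩
  · rw [hpos, act_indexHead, hc.indexHead_high]
    rfl
  · rw [funext fun r => (key r).1, digitsValue_next, hc.value]
    exact fun h => hend fun r => (hc.atEnd_iff r).2 (h r)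

theorem Rel.perform {L i : ℕ} {c : M.Cfg} (hc : Rel L i c c')
    (hend : ¬ ∀ r, atEnd (ix c') r = true)
    (A : RATMAction M.State (Fin 2) M.Work (Option (Bool ⊕ M.Aux))) :
    Rel L (i + 1) (act c A) (act c' (perform (wk c') (ix c') A)) := by
  have hnext : (clock.perform (wk c') (ix c') A).next = (clock M k).access ↔
      A.next = M.access := by
    simp [clock.perform]
  have hindex : ∀ T, (act c' (clock.perform (wk c') (ix c') A)).index (orig T) =
      (act c A).index T := by
    intro T
    rw [act_index, act_index, hc.index, hc.indexHead]
    rcases T with i | w <;> rfl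
  refine ⟨hc.toShows.perform hend A, rfl, fun w => ?_, hindex, fun T => ?_, fun T => ?_⟩
  · have := hc.head (.inr w)
    rw [act_work, act_work, hc.work, this]
    rfl
  · by_cases hs : A.next = M.access
    · rw [act_head_of_eq hs, act_head_of_eq (hnext.2 hs)]
      exact congrArg address (hindex T)
    · rw [act_head_of_ne hs, act_head_of_ne (mt hnext.1 hs), hc.head]
      rcases T with i | w <;> rfl
  · rw [act_indexHead, act_indexHead, hc.indexHead]
    rcases T with i | w <;> rfl

open Classical in
theorem actionT_sim {L i : ℕ} {c : M.Cfg} (hc : Rel L i c c') :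
    (clock M k).actionT X c' = if ∀ r, atEnd (ix c') r = true then none else
      (M.actionT X c).map (clock.perform (wk c') (ix c')) := by
  have hflag : ∀ e, ix c' (flag e) = true := fun e => by
    simp only [ix, hc.index_flag, hc.indexHead_flag]; rfl
  have h1 : (fun i : Fin 2 => X i (c'.head (.inl i))) = fun i => X i (c.head (.inl i)) :=
    funext fun i => by rw [← hc.head (.inl i)]
  have h2 : (fun w => wk c' (.inl w)) = fun w => c.work w (c.head (.inr w)) :=
    funext fun w => by
      have := hc.head (.inr w)
      simp only [wk, hc.work, this]
  have h3 : (fun T => ix c' (orig T)) = fun T => decide (c.indexHead T ∈ c.index T) :=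
    funext fun T => by simp only [ix, hc.index, hc.indexHead]
  change delta M k c'.state (fun i => X i (c'.head (.inl i))) (wk c') (ix c') = _
  rw [hc.state, h1]
  simp only [delta, hflag, h2, h3]
  rfl

theorem Rel.step {L i : ℕ} {c : M.Cfg} (hc : Rel L i c c')
    {A : RATMAction M.State (Fin 2) M.Work (Option (Bool ⊕ M.Aux))}
    (hA : M.actionT X c = some A) (hi : i + 1 < (L + 1) ^ (k + 1)) :
    Rel L (i + 1) (act c A) ((clock M k).stepT X c') := by
  have hend : ¬ ∀ r, atEnd (ix c') r = true := by
    intro h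
    have := digitsValue_max L _ fun r => (hc.atEnd_iff r).1 (h r)
    rw [hc.value] at this
    omega
  have h := actionT_sim (X := X) hc
  rw [hA, Option.map_some, if_neg hend] at h
  rw [stepT_of_some h]
  exact hc.perform hend A

/-- Each simulated step advances the clock by one, so either `M` halts on its own or all digits
reach their ends. -/
theorem Rel.halts {L i : ℕ} {c : M.Cfg} (hc : Rel L i c c') (d : ℕ)
    (hd : i + d + 1 = (L + 1) ^ (k + 1)) :
    (clock M k).actionT X (((clock M k).stepT X)^[d] c') = none := by
  induction d generalizing i c c' with
  | zero =>
    have h := actionT_sim (X := X) hc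
    by_cases hend : ∀ r, atEnd (ix c') r = true
    · rwa [if_pos hend] at h
    · have h₁ := digitsValue_next L _ fun h => hend fun r => (hc.atEnd_iff r).2 (h r)
      -- The action is an arbitrary one: only the digits after a further tick matter. They would
      -- still be at most `L`, yet their value would be `(L + 1) ^ (k + 1)`.
      have h₂ := (hc.toShows.perform hend
        { next := M.start, write := fun _ => none, writeIndex := fun _ => false,
          move := fun _ => .stay, moveIndex := fun _ => .stay })
      have h₃ := digitsValue_lt L _ h₂.digits_le
      rw [h₂.value] at h₃
      omega
  | succ d ih =>
    cases hA : M.actionT X c with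
    | none =>
      have h := actionT_sim (X := X) hc
      have h' : (clock M k).actionT X c' = none := by
        rw [h, hA, Option.map_none, ite_self]
      rwa [iterate_stepT_of_none h']
    | some A =>
      rw [Function.iterate_succ_apply]
      exact ih (hc.step hA (by omega)) (by omega)

theorem exists_start {J : ℕ} (hJ : ∀ i, X i (2 ^ J) = none) :
    ∃ s, s ≤ 3 * J + 6 ∧ ∃ L, L ≤ J ∧ (∀ i, X i (2 ^ L) = none) ∧
      Rel (L + 1) 0 M.init (((clock M k).stepT X)^[s] (clock M k).init) := by
  obtain ⟨s₁, h₁, L, hL, hX, P⟩ := (check_init (X := X) (M := M) (k := k)).measure hJ J (by omega)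
  obtain ⟨s₂, h₂, R⟩ := (P.markHigh (X := X)).back (X := X)
  have hR := R.launch (X := X)
  -- One initial step, at most `2 * J + 1` for measuring, one for marking, at most `L + 2` for
  -- moving back, and one for the launch. The digits run up to `L + 1` because the last probe has
  -- already moved the index heads on.
  refine ⟨1 + (s₂ + (1 + (s₁ + 1))), by omega, L, hL, hX, ?_⟩
  simpa only [Function.iterate_add_apply, Function.iterate_one] using hR

/-- The machine with a clock always halts in time; if the original machine does so, too, then the
results agree. -/
theorem haltsWith {J : ℕ} (hJ : ∀ i, X i (2 ^ J) = none) :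
    ∃ Y, (clock M k).HaltsWith X (3 * J + 6 + (J + 2) ^ (k + 1)) Y ∧ ∀ t Y',
      M.HaltsWith X t Y' → (∀ L, (∀ i, X i (2 ^ L) = none) → t < (L + 2) ^ (k + 1)) → Y = Y' := by
  obtain ⟨s, hs, L, hL, hX, hR⟩ := exists_start (M := M) (k := k) hJ
  have hpos : 0 < (L + 1 + 1) ^ (k + 1) := Nat.pow_pos (by omega)
  have hle : (L + 1 + 1) ^ (k + 1) ≤ (J + 2) ^ (k + 1) := Nat.pow_le_pow_left (by omega) _
  have hhalt := hR.halts (X := X) ((L + 1 + 1) ^ (k + 1) - 1) (by omega)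
  rw [← Function.iterate_add_apply] at hhalt
  have hH : (clock M k).HaltsWith X ((L + 1 + 1) ^ (k + 1) - 1 + s) _ := ⟨hhalt, rfl⟩
  refine ⟨_, hH.mono (by omega), fun t Y' h ht => ?_⟩
  have ht' : t < (L + 1 + 1) ^ (k + 1) := ht L hX
  obtain ⟨j, -, s', hs', R⟩ := simulate (R := Rel (L + 1)) (X := X) (X' := X)
    (T := (L + 1 + 1) ^ (k + 1) - 1) (K := 1)
    (fun i hi c c' A hc hA => ⟨1, le_rfl, hc.step hA (by omega)⟩) t 0 (by omega) hR
  have hend := actionT_sim (X := X) R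
  rw [h.1, Option.map_none, ite_self, ← Function.iterate_add_apply] at hend
  have hw := R.work M.out
  rw [h.2, ← Function.iterate_add_apply] at hw
  have hH' : (clock M k).HaltsWith X (s' + s) Y' := ⟨hend, hw⟩
  -- Both facts describe the same run, so they are compared at the later of the two times.
  have e₁ := (hH.mono (le_max_left _ (s' + s))).2
  have e₂ := (hH'.mono (le_max_right ((L + 1 + 1) ^ (k + 1) - 1 + s) _)).2
  exact e₁.symm.trans e₂

end clock

end RATM

/-! ### Reductions compose -/

/-! ### Extracting a string from an output tape -/

namespace RATM

/-- The machine that copies argument `1`, up to its first blank. -/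
abbrev copier : RATM 2 where
  State := Bool
  finite_state := inferInstance
  Work := Unit
  finite_work := inferInstance
  Aux := Empty
  finite_aux := inferInstance
  out := ()
  start := false
  access := true
  δ := fun _ inp _ _ => (inp 1).map fun e =>
    { next := false
      write := fun _ => some (.inl e)
      writeIndex := fun _ => false
      move := fun _ => .right
      moveIndex := fun _ => .stay }

namespace copier

theorem run {X : Fin 2 → ℕ → Option Bool} {m : ℕ} (h : ∀ j, j < m → X 1 j ≠ none) (t : ℕ)
    (ht : t ≤ m) : (∀ T, ((copier.stepT X)^[t] copier.init).head T = t) ∧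
      ∀ j, ((copier.stepT X)^[t] copier.init).work () j =
        if j < t then (X 1 j).map .inl else none := by
  induction t with
  | zero => exact ⟨fun _ => rfl, fun j => rfl⟩
  | succ t ih =>
    obtain ⟨h₁, h₂⟩ := ih (by omega)
    rw [Function.iterate_succ_apply']
    generalize (copier.stepT X)^[t] copier.init = c at h₁ h₂
    obtain ⟨e, he⟩ := Option.ne_none_iff_exists'.1 (h t (by omega))
    have hA : copier.actionT X c = some
        { next := false
          write := fun _ => some (.inl e)
          writeIndex := fun _ => false
          move := fun _ => .right
          moveIndex := fun _ => .stay } := by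
      have hX : X 1 (c.head (.inl 1)) = some e := by rw [h₁, he]
      change (X 1 (c.head (.inl 1))).map _ = _
      rw [hX]; rfl
    rw [stepT_of_some hA]
    refine ⟨fun T => ?_, fun j => ?_⟩
    · rw [act_head_of_ne (by simp), h₁]; rfl
    · rw [act_work, h₁]
      by_cases hj : j = t
      · rw [hj, Function.update_self, if_pos (by omega), he]; rfl
      · rw [Function.update_of_ne hj, h₂]
        by_cases hjt : j < t
        · rw [if_pos hjt, if_pos (by omega)]
        · rw [if_neg hjt, if_neg (by omega)]

theorem haltsWith {X : Fin 2 → ℕ → Option Bool} {m : ℕ} (hm : X 1 m = none)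
    (h : ∀ j, j < m → X 1 j ≠ none) :
    ∃ y : List Bool, (∀ j, y[j]? = if j < m then X 1 j else none) ∧
      copier.HaltsWith X m fun j => (y[j]?).map .inl := by
  -- The default `false` never occurs, because the cells before `m` are not blank.
  have hy : ∀ j, ((List.range m).map fun j => (X 1 j).getD false)[j]? =
      if j < m then X 1 j else none := by
    intro j
    by_cases hj : j < m
    · obtain ⟨e, he⟩ := Option.ne_none_iff_exists'.1 (h j hj)
      simp [hj, he]
    · simp [hj]
  refine ⟨_, hy, ?_, ?_⟩
  · have hX : X 1 (((copier.stepT X)^[m] copier.init).head (.inl 1)) = none := by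
      rw [(run h m le_rfl).1, hm]
    change (X 1 (((copier.stepT X)^[m] copier.init).head (.inl 1))).map _ = none
    rw [hX]; rfl
  · funext j
    rw [(run h m le_rfl).2, hy]
    split_ifs <;> rfl

end copier

end RATM

/-! ### Total extensions and composition of PPL computable functions -/

open RATM

theorem PPLComputable.of_bounds {a : ℕ} {g : (Fin a → List Bool) → List Bool} (M : RATM a)
    {b : ℕ → ℕ} (hb : PolylogBdd b)
    (h : ∀ x, M.OutputsWithin x (b (∑ i, (x i).length)) (g x)) : PPLComputable g := by
  obtain ⟨d, k, hd⟩ := hb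
  exact ⟨M, d, k, fun x =>
    outputsWithin_iff.2 ((outputsWithin_iff.1 (h x)).mono (hd _))⟩

/-- The partial function that a machine computes in polylogarithmic time has a total extension that
is PPL computable. -/
theorem RATM.exists_pplComputable (M : RATM 2) {b : ℕ → ℕ} (hb : PolylogBdd b) :
    ∃ G : (Fin 2 → List Bool) → List Bool, PPLComputable G ∧
      ∀ x y, M.OutputsWithin x (b (∑ i, (x i).length)) y → G x = y := by
  obtain ⟨d, k, hd⟩ := hb
  -- This is the time bound of the clocked machine with `J = l + 1`. The clock gets `d` digits more
  -- than the exponent `k` suggests in order to absorb the constant factor `d`.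
  let S : ℕ → ℕ := fun l => 3 * (l + 1) + 6 + (l + 1 + 2) ^ (k + d + 1)
  have hS : PolyBdd S := ((((PolyBdd.const 3).mul (PolyBdd.id.add (.const 1))).add (.const 6)).add
    (((PolyBdd.id.add (.const 1)).add (.const 2)).pow _))
  have key : ∀ x : Fin 2 → List Bool, ∃ y,
      (compose (clock M (k + d)) copier).OutputsWithin x
        (5 * S (Nat.log 2 (∑ i, (x i).length)) + 5) y ∧
      ∀ y', M.OutputsWithin x (b (∑ i, (x i).length)) y' → y = y' := by
    intro x
    set n := ∑ i, (x i).length with hn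
    have hxn : n = (x 0).length + (x 1).length := Fin.sum_univ_two _
    have hJ : ∀ i, tapes x i (2 ^ (Nat.log 2 n + 1)) = none := by
      intro i
      have h₁ : n < 2 ^ (Nat.log 2 n + 1) := Nat.lt_pow_succ_log_self (by omega) n
      refine List.getElem?_eq_none ?_
      fin_cases i <;> simp only [Fin.zero_eta, Fin.mk_one] <;> omega
    obtain ⟨Y, hY, hYM⟩ := clock.haltsWith (M := M) (k := k + d) hJ
    obtain ⟨s, hs, hsY⟩ := hY.exists_support
    -- Within `S` steps at most `S` cells become nonblank, so one of the first `S + 1` cells is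
    -- blank and the copier stops in time even on a meaningless output.
    have hex : ∃ m, m ≤ S (Nat.log 2 n) ∧ bitOf (Y m) = none := by
      by_contra! hcon
      have : Finset.range (S (Nat.log 2 n) + 1) ⊆ s := fun j hj =>
        hsY j fun h => hcon j (Nat.lt_succ_iff.1 (Finset.mem_range.1 hj)) (by rw [h]; rfl)
      have := Finset.card_le_card this
      rw [Finset.card_range] at this
      change s.card ≤ S (Nat.log 2 n) at hs
      omega
    classical
    have hex' : ∃ m, bitOf (Y m) = none := hex.imp fun m h => h.2
    have hle : Nat.find hex' ≤ S (Nat.log 2 n) := by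
      obtain ⟨m, h₁, h₂⟩ := hex
      exact (Nat.find_min' hex' h₂).trans h₁
    obtain ⟨y, hy, hcopy⟩ := copier.haltsWith (X := compose.tapes₂ (tapes x) Y)
      (Nat.find_spec hex') fun j hj => Nat.find_min hex' hj
    refine ⟨y, outputsWithin_iff.2 ?_, fun y' hy' => ?_⟩
    · have := compose.haltsWith hY hcopy
      convert this.mono _ using 1
      · funext j
        cases y[j]? <;> rfl
      · change 4 * S (Nat.log 2 n) + Nat.find hex' + 5 ≤ _
        omega
    · have hYy : Y = fun j => (y'[j]?).map .inl := by
        refine hYM _ _ (outputsWithin_iff.1 hy') fun L hL => ?_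
        have h0 : (x 0).length ≤ 2 ^ L := List.getElem?_eq_none_iff.1 (hL 0)
        have h1 : (x 1).length ≤ 2 ^ L := List.getElem?_eq_none_iff.1 (hL 1)
        -- The number `n` is the sum of two lengths that are at most `2 ^ L` each.
        have hl : Nat.log 2 n ≤ L + 1 := by
          calc Nat.log 2 n ≤ Nat.log 2 (2 ^ (L + 1)) := Nat.log_mono_right (by
                rw [pow_succ]; omega)
            _ = L + 1 := Nat.log_pow (by omega) _
        -- The factor `d` is replaced by `(L + 2) ^ (d + 1)`, using `d < 2 ^ (d + 1)`; so the clock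
        -- does not expire before `M` halts.
        calc b n ≤ d * (Nat.log 2 n + 1) ^ k := hd n
          _ ≤ d * (L + 2) ^ k := Nat.mul_le_mul_left _ (Nat.pow_le_pow_left (by omega) _)
          _ < 2 ^ (d + 1) * (L + 2) ^ k := by
            have h₁ : d < 2 ^ (d + 1) := Nat.lt_two_pow_self.trans
              (Nat.pow_lt_pow_right (by omega) (by omega))
            exact Nat.mul_lt_mul_of_pos_right h₁ (Nat.pow_pos (by omega))
          _ ≤ (L + 2) ^ (d + 1) * (L + 2) ^ k := by gcongr; omega
          _ = (L + 2) ^ (k + d + 1) := by rw [← pow_add]; congr 1; omega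
      have hbit : ∀ j, compose.tapes₂ (tapes x) Y 1 j = y'[j]? := by
        intro j
        change bitOf (Y j) = _
        rw [hYy]
        cases hj : y'[j]? <;> simp [hj, bitOf]
      refine List.ext_getElem? fun j => ?_
      rw [hy, hbit]
      split_ifs with hj
      · rfl
      · have hm : y'[Nat.find hex']? = none := (hbit _).symm.trans (Nat.find_spec hex')
        rw [List.getElem?_eq_none_iff] at hm
        exact (List.getElem?_eq_none (by omega)).symm
  choose G hG₁ hG₂ using key
  refine ⟨G, .of_bounds _ (b := fun n => 5 * S (Nat.log 2 n) + 5) ?_ hG₁, hG₂⟩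
  exact ((PolylogBdd.const 5).mul (PolylogBdd.of_polyBdd hS)).add (.const 5)

/-- The equation is demanded on codes of pairs only. Elsewhere the values of `G` are those of a
total extension, and the reduction never uses them. -/
theorem PPLComputable.exists_comp {g g' : (Fin 2 → List Bool) → List Bool} (hg : PPLComputable g)
    (hg' : PPLComputable g') : ∃ G : (Fin 2 → List Bool) → List Bool, PPLComputable G ∧
      ∀ u v P, G ![pairEnc u v, P] = g' ![u, g ![v, P]] := by
  obtain ⟨M, d, k, hM⟩ := hg
  obtain ⟨M', d', k', hM'⟩ := hg'
  let t₁ : ℕ → ℕ := fun n => d * (Nat.log 2 n + 1) ^ k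
  -- The second machine reads `u` and the output of the first one, whose length is at most the
  -- running time `t₁ n`.
  let t₂ : ℕ → ℕ := fun n => d' * (Nat.log 2 (n + t₁ n) + 1) ^ k'
  have ht₁ : PolylogBdd t₁ := .monomial d k
  have ht₂ : PolylogBdd t₂ :=
    (PolylogBdd.monomial d' k').comp_polyBdd (PolyBdd.id.add ht₁.polyBdd)
  -- Both machines read their component from the same input tape `0`: the first takes `v`, the
  -- second `u`. Only the other argument of the second machine comes from the output of the first.
  obtain ⟨G, hG, h⟩ := (compose (decode M true) (decode M' false)).exists_pplComputable
    (b := fun n => 4 * (13 * t₁ n + 7) + (13 * t₂ n + 7) + 5)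
    (((((PolylogBdd.const 4).mul (((PolylogBdd.const 13).mul ht₁).add (.const 7)))).add
      (((PolylogBdd.const 13).mul ht₂).add (.const 7))).add (.const 5))
  refine ⟨G, hG, fun u v P => h _ _ (outputsWithin_iff.2 ?_)⟩
  have hlen := length_pairEnc u v
  have hn : ∑ i, ((![pairEnc u v, P] : Fin 2 → List Bool) i).length =
      (pairEnc u v).length + P.length := Fin.sum_univ_two _
  rw [hn]
  set n := (pairEnc u v).length + P.length
  have h₁ : M.OutputsWithin ![v, P] (t₁ n) (g ![v, P]) := by
    refine outputsWithin_iff.2 ((outputsWithin_iff.1 (hM _)).mono ?_)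
    have : ∑ i, ((![v, P] : Fin 2 → List Bool) i).length ≤ n := by
      rw [Fin.sum_univ_two]
      change v.length + P.length ≤ n
      omega
    have := Nat.log_mono_right (b := 2) this
    change _ ≤ d * (Nat.log 2 n + 1) ^ k
    gcongr
  have hQ := h₁.length_le
  have h₂ : M'.OutputsWithin ![u, g ![v, P]] (t₂ n) (g' ![u, g ![v, P]]) := by
    refine outputsWithin_iff.2 ((outputsWithin_iff.1 (hM' _)).mono ?_)
    have : ∑ i, ((![u, g ![v, P]] : Fin 2 → List Bool) i).length ≤ n + t₁ n := by
      rw [Fin.sum_univ_two]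
      change u.length + (g ![v, P]).length ≤ n + t₁ n
      omega
    have := Nat.log_mono_right (b := 2) this
    change _ ≤ d' * (Nat.log 2 (n + t₁ n) + 1) ^ k'
    gcongr
  have e₁ := decode.haltsWith_pairEnc (b := true) (u := u) (v := v) (outputsWithin_iff.1 h₁)
  have e₂ := decode.haltsWith_pairEnc (b := false) (u := u) (v := v) (outputsWithin_iff.1 h₂)
  have htapes : tapes ![pairEnc u v, g ![v, P]] = compose.tapes₂ (tapes ![pairEnc u v, P])
      fun j => ((g ![v, P])[j]?).map (Sum.inl : Bool → Bool ⊕ (decode M true).Aux) := by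
    funext i j
    fin_cases i
    · rfl
    · change (g ![v, P])[j]? = bitOf (((g ![v, P])[j]?).map _)
      cases (g ![v, P])[j]? <;> rfl
  rw [htapes] at e₂
  convert compose.haltsWith e₁ e₂ using 1
  funext j
  cases (g' ![u, g ![v, P]])[j]? <;> rfl

theorem theorem6 (P₁ P₂ P₃ : DecisionProblem)
    (h₁₂ : PsPLReducible P₁ P₂) (h₂₃ : PsPLReducible P₂ P₃) :
    PsPLReducible P₁ P₃ := by
  obtain ⟨f₁, f₂, g, hf₁, hf₂, hg, h⟩ := h₁₂
  obtain ⟨f₁', f₂', g', hf₁', hf₂', hg', h'⟩ := h₂₃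
  obtain ⟨G, hG, hGg⟩ := hg.exists_comp hg'
  refine ⟨fun D => f₁' (f₁ D), fun D => pairEnc (f₂' (f₁ D)) (f₂ D), fun z P => G ![z, P],
    hf₁'.comp hf₁, (hf₂'.comp hf₁).pair hf₂, ?_, fun D P => ?_⟩
  · have : (fun x : Fin 2 → List Bool => G ![x 0, x 1]) = G := by
      funext x
      congr 1
      funext i
      fin_cases i <;> rfl
    rwa [← this] at hG
  · change _ ↔ (f₁' (f₁ D), G ![pairEnc (f₂' (f₁ D)) (f₂ D), P]) ∈ P₃
    rw [hGg]
    exact (h D P).trans (h' _ _)
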